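/- **Model.** There are $n$ asynchronous processes, a threshold $t$ with $3t<n$, and a fixed set of at most $t$ faulty (Byzantine) processes; every process $i$ has a proposal $v_i\in\{0,1\}$. Messages are signed, signatures cannot be forged, and the channels between non-faulty processes are reliable. Each round $r\ge 1$ has a global coin; the coin outputs are independent fair bits, and the output for round $r$ is revealed exactly when $n-t$ processes have signed a message $\mathrm{COIN}[r]$. An adversary controls the scheduling, the message delays and the faulty processes. It chooses each step as an arbitrary function of everything that has happened so far (including the internal states of all processes) and of the coins already revealed. For almost every sequence of coin outputs the resulting execution must be admissible: no message from a non-faulty process to a non-faulty process is postponed forever, and no non-faulty process is stopped forever. **Algorithm** (of a non-faulty process $i$). Broadcast the signed message $\mathrm{AUX}[0](v_i)$ and wait for round-$0$ AUX messages from $n-t$ processes. Set $est\leftarrow 0$ if $\mathrm{AUX}[0](0)$ was received from at least $t+1$ processes, and $est\leftarrow 1$ otherwise. Then, for $r=1,2,\dots$: 1. Broadcast the signed message $\mathrm{AUX}[r](est)$ together with a set of already received signed AUX messages that proves $est$ valid for $r$. 2. Wait for valid $\mathrm{AUX}[r]$ messages from $n-t$ processes. If $n-t$ processes sent a valid $\mathrm{AUX}[r](b)$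 for one bit $b$, set $est\leftarrow b$; otherwise set $est\leftarrow\textsc{c\_val}$ (a placeholder for the coin). 3. Sign and broadcast $\mathrm{COIN}[r]$, wait for $\mathrm{COIN}[r]$ from $n-t$ processes, and learn the coin $c_r$. 4. If valid $\mathrm{AUX}[r](c_r)$ messages from $n-t$ processes have been received, decide $c_r$ (unless already decided). If $est=\textsc{c\_val}$, set $est\leftarrow c_r$. Every round-$0$ AUX message is valid. A set of signed messages proves $b$ valid for round $1$ if it contains $\mathrm{AUX}[0](b)$ from $t+1$ processes. For $r\ge 2$ let $p$ be the largest round $1\le p<r$ with $c_p=\neg b$, and $p=0$ if there is none; the set proves $b$ valid for round $r$ if it contains $\mathrm{AUX}[p](b)$ from $n-t$ processes, or if $p=0$ and it contains $\mathrm{AUX}[0](b)$ from $t+1$ processes. A received $\mathrm{AUX}[r]$ message is checked once the receiver knows $c_1,\dots,c_{r-1}$. If the proofs attached to it prove its value valid for $r$, then the message is stored together with a minimal proving subset of those proofs; otherwise it is ignored. **Definition.** Decision is *guaranteed at round* $s\ge 1$ if the coin of round $s$ is revealed at some moment and, in every admissible continuation of the execution from that moment (whatever the adversary does and whatever the later coins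 are), every non-faulty process decides by the next round $r>s$ with $c_r=c_s$. **Lemma (termination).** The algorithm terminates in an expected $O(1)$ number of rounds. More precisely, for all $n,t$, faulty sets, proposals and adversaries as above: 1. for every round $r\ge1$, conditionally on any values of the coins of the rounds before $r$, with probability at least $1/2$ decision is guaranteed at round $r$ or at round $r+1$; 2. the expected value of the first round at which decision is guaranteed is at most $4$; 3. the expected value of the least round $R$ such that every non-faulty process decides in round $R$ or earlier is at most $6$. -/

import Mathlib

open MeasureTheory ProbabilityTheory
open scoped ENNReal

namespace BBC

/-! ## Messages

Binary values are Booleans (`0` is `false`, `1` is `true`). Signatures are ideal: a signed message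
carries its signer, and `Authentic` below expresses that signatures cannot be forged. -/

/-- `⟨AUX[round](val)⟩_signer`: an AUX message signed by process `signer`. -/
structure Aux (n : ℕ) where
  signer : Fin n
  round : ℕ
  val : Bool
deriving DecidableEq

/-- A signed AUX message together with the set of signed AUX messages that is to prove it valid. -/
structure AuxProof (n : ℕ) where
  aux : Aux n
  proofs : Finset (Aux n)
deriving DecidableEq

/-- The processes that signed some `AUX[r](b)` message in `S`. -/
def signers {n : ℕ} (S : Finset (Aux n)) (r : ℕ) (b : Bool) : Finset (Fin n) :=
  (S.filter (fun a => a.round = r ∧ a.val = b)).image Aux.signer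

/-- The processes that signed some `AUX[r]` message in `S`. -/
def senders {n : ℕ} (S : Finset (Aux n)) (r : ℕ) : Finset (Fin n) :=
  (S.filter (fun a => a.round = r)).image Aux.signer

/-! ## The predicate `is_valid` -/

/-- The largest round `r' < r` in which the coin was `¬ est`, or `0` if there is none. -/
def prevRound (coinMap : ℕ → Option Bool) (r : ℕ) (est : Bool) : ℕ :=
  ((Finset.range r).filter (fun r' => coinMap r' = some (!est))).sup id

/-- The predicate `is_valid(r, est, proofs)`, evaluated with the coin values in `coinMap`. -/
def IsValid {n : ℕ} (t : ℕ) (coinMap : ℕ → Option Bool) (r : ℕ) (est : Bool)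
    (proofs : Finset (Aux n)) : Prop :=
  if r = 0 then True
  else if r = 1 then t + 1 ≤ (signers proofs 0 est).card
  else
    (prevRound coinMap r est = 0 ∧ t + 1 ≤ (signers proofs 0 est).card) ∨
      n - t ≤ (signers proofs (prevRound coinMap r est) est).card

instance {n : ℕ} (t : ℕ) (coinMap : ℕ → Option Bool) (r : ℕ) (est : Bool)
    (proofs : Finset (Aux n)) : Decidable (IsValid t coinMap r est proofs) := by
  unfold IsValid; infer_instance

/-! ## States -/

/-- Where a process stands in its program. -/
inductive Phase where
  /-- about to broadcast its proposal -/
  | start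
  /-- waiting for `n - t` round `0` AUX messages -/
  | waitInit
  /-- about to enter the next round (or the next iteration of the loop) -/
  | nextRound
  /-- waiting for `n - t` AUX messages of the current round -/
  | waitAux
  /-- waiting for `n - t` COIN messages of the current round -/
  | waitCoin
  /-- the coin of the current round is known; about to decide, and to update the estimate -/
  | coinKnown
deriving DecidableEq

/-- Local state of a process. An estimate `none` stands for `c_val` ("take the coin"). -/
structure Local (n : ℕ) where
  phase : Phase
  round : ℕ
  est : Option Bool
  coinMap : ℕ → Option Bool
  auxValues : Finset (Aux n)
  decision : Option Bool
  /-- the AUX messages (with proofs) received and handled so far -/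
  auxRecv : Finset (AuxProof n)
  /-- the COIN messages received so far: signer and round -/
  coinRecv : Finset (Fin n × ℕ)

/-- Global state. -/
structure Config (n : ℕ) where
  proc : Fin n → Local n
  /-- the AUX messages (with proofs) broadcast so far by the non-faulty processes -/
  auxSent : Finset (AuxProof n)
  /-- the COIN messages signed so far, by any process: signer and round -/
  coinSent : Finset (Fin n × ℕ)

/-- The data of one instance: the threshold `t`, the faulty processes, the proposals. -/
structure Instance (n : ℕ) where
  t : ℕ
  faulty : Finset (Fin n)
  proposal : Fin n → Bool

variable {n : ℕ}

def Config.initial (n : ℕ) : Config n where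
  proc := fun _ => ⟨.start, 0, none, fun _ => none, ∅, none, ∅, ∅⟩
  auxSent := ∅
  coinSent := ∅

def Config.setProc (σ : Config n) (i : Fin n) (p : Local n) : Config n :=
  { σ with proc := Function.update σ.proc i p }

/-- Signatures cannot be forged: a signed AUX message can exist only if its signer is faulty or
really signed and broadcast it. -/
def Authentic (I : Instance n) (σ : Config n) (a : Aux n) : Prop :=
  a.signer ∈ I.faulty ∨ a ∈ σ.auxSent.image AuxProof.aux

instance (I : Instance n) (σ : Config n) (a : Aux n) : Decidable (Authentic I σ a) := by
  unfold Authentic; infer_instance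

/-- The processes that have participated in the flip of the coin of round `r`. -/
def participants (σ : Config n) (r : ℕ) : Finset (Fin n) :=
  (σ.coinSent.filter (fun x => x.2 = r)).image Prod.fst

/-- The coin of round `r` is revealed: `n - t` processes have participated in its flip. -/
def Revealed (I : Instance n) (σ : Config n) (r : ℕ) : Prop :=
  n - I.t ≤ (participants σ r).card

instance (I : Instance n) (σ : Config n) (r : ℕ) : Decidable (Revealed I σ r) := by
  unfold Revealed; infer_instance

/-- The process knows the coins of all rounds `1, …, r - 1`. -/
def KnowsCoinsBelow (p : Local n) (r : ℕ) : Prop :=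
  ∀ r' ∈ Finset.Ico 1 r, p.coinMap r' ≠ none

instance (p : Local n) (r : ℕ) : Decidable (KnowsCoinsBelow p r) := by
  unfold KnowsCoinsBelow; infer_instance

/-! ## The algorithm -/

/-- The next step of the main program of process `i`, or `none` if the process has to wait.
`coin r` is the output of the coin of round `r`; it is read only once `n - t` COIN messages of
round `r` have been received. `P` is the set of proofs that the process computes when it enters a
round. -/
def proceed? (I : Instance n) (coin : ℕ → Bool) (σ : Config n) (i : Fin n)
    (P : Finset (Aux n)) : Option (Config n) :=
  let p := σ.proc i
  match p.phase with
  | .start =>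
      some { σ.setProc i { p with phase := .waitInit } with
        auxSent := insert ⟨⟨i, 0, I.proposal i⟩, ∅⟩ σ.auxSent }
  | .waitInit =>
      if n - I.t ≤ (senders p.auxValues 0).card then
        some (σ.setProc i { p with
          est := if I.t + 1 ≤ (signers p.auxValues 0 false).card then some false else some true
          phase := .nextRound })
      else none
  | .nextRound =>
      match p.est with
      | none => none
      | some v =>
        if P ⊆ p.auxValues ∧ IsValid I.t p.coinMap (p.round + 1) v P then
          some { σ.setProc i { p with round := p.round + 1, phase := .waitAux } with
            auxSent := insert ⟨⟨i, p.round + 1, v⟩, P⟩ σ.auxSent }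
        else none
  | .waitAux =>
      if n - I.t ≤ (senders p.auxValues p.round).card then
        some { σ.setProc i { p with
            est := if n - I.t ≤ (signers p.auxValues p.round true).card then some true
              else if n - I.t ≤ (signers p.auxValues p.round false).card then some false
              else none
            phase := .waitCoin } with
          coinSent := insert (i, p.round) σ.coinSent }
      else none
  | .waitCoin =>
      if n - I.t ≤ ((p.coinRecv.filter (fun x => x.2 = p.round)).image Prod.fst).card then
        some (σ.setProc i { p with
          coinMap := Function.update p.coinMap p.round (some (coin p.round))
          phase := .coinKnown })
      else none
  | .coinKnown =>
      match p.coinMap p.round with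
      | none => none
      | some b =>
        some (σ.setProc i { p with
          decision := if p.decision = none ∧ n - I.t ≤ (signers p.auxValues p.round b).card
            then some b else p.decision
          est := if p.est = none then some b else p.est
          phase := .nextRound })

/-- What the adversary, who controls the scheduling, the network and the faulty processes, can do
in one step. -/
inductive Action (n : ℕ) where
  /-- Process `i` receives `m`. If `m` is valid then `kept` is the part of its proofs that `i`
  keeps. -/
  | deliverAux (i : Fin n) (m : AuxProof n) (kept : Finset (Aux n))
  /-- Process `i` receives the COIN message of round `r` signed by `j`. -/
  | deliverCoin (i j : Fin n) (r : ℕ)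
  /-- The faulty process `j` signs the COIN message of round `r`. -/
  | signCoin (j : Fin n) (r : ℕ)
  /-- Process `i` executes the next step of its main program, if it does not have to wait. -/
  | proceed (i : Fin n) (P : Finset (Aux n))

/-- The effect of an action; an action that is not possible has no effect.

Faulty processes may sign any AUX and COIN messages and combine all signed messages that exist into
any AUX message with proofs, and have it received by any process at any time. The handling of an
AUX message of round `r` is held back until the receiver knows the coins of the rounds before `r`,
since these enter into `is_valid`. -/
def step (I : Instance n) (coin : ℕ → Bool) (σ : Config n) : Action n → Config n
  | .deliverAux i m kept =>
      let p := σ.proc i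
      if i ∉ I.faulty ∧ Authentic I σ m.aux ∧ (∀ a ∈ m.proofs, Authentic I σ a) ∧
          KnowsCoinsBelow p m.aux.round then
        if IsValid I.t p.coinMap m.aux.round m.aux.val m.proofs then
          if kept ⊆ m.proofs ∧ IsValid I.t p.coinMap m.aux.round m.aux.val kept ∧
              (∀ a ∈ kept, ¬ IsValid I.t p.coinMap m.aux.round m.aux.val (kept.erase a)) then
            σ.setProc i { p with
              auxRecv := insert m p.auxRecv
              auxValues := insert m.aux (p.auxValues ∪ kept) }
          else σ
        else σ.setProc i { p with auxRecv := insert m p.auxRecv }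
      else σ
  | .deliverCoin i j r =>
      if i ∉ I.faulty ∧ (j, r) ∈ σ.coinSent then
        σ.setProc i { σ.proc i with coinRecv := insert (j, r) (σ.proc i).coinRecv }
      else σ
  | .signCoin j r =>
      if j ∈ I.faulty then { σ with coinSent := insert (j, r) σ.coinSent } else σ
  | .proceed i P =>
      if i ∉ I.faulty then (proceed? I coin σ i P).getD σ else σ

/-! ## Adversaries and executions -/

/-- What the adversary sees at one point of time: the whole state of the system, and the outputs of
the coins that are already revealed (`none` for the others). -/
structure View (n : ℕ) where
  config : Config n
  coins : ℕ → Option Bool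

def view (I : Instance n) (coin : ℕ → Bool) (σ : Config n) : View n where
  config := σ
  coins := fun r => if Revealed I σ r then some (coin r) else none

/-- An adversary chooses its next action from everything it has seen so far (newest view first).
It is adaptive and computationally unbounded, and learns the output of a coin only when the coin
is revealed. (A randomized adversary is a random choice among these.) -/
abbrev Adversary (n : ℕ) := List (View n) → Action n

/-- The state after `k` steps, with the list of all earlier views. -/
def runAux (I : Instance n) (adv : Adversary n) (coin : ℕ → Bool) :
    ℕ → Config n × List (View n)
  | 0 => (Config.initial n, [])
  | k + 1 =>
      let s := runAux I adv coin k
      let h := view I coin s.1 :: s.2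
      (step I coin s.1 (adv h), h)

/-- The state after `k` steps of the execution against `adv` with coin outputs `coin`. -/
def run (I : Instance n) (adv : Adversary n) (coin : ℕ → Bool) (k : ℕ) : Config n :=
  (runAux I adv coin k).1

/-- An admissible execution: messages of non-faulty processes to non-faulty processes are not
postponed forever, and no non-faulty process is stopped forever. -/
structure Admissible (I : Instance n) (adv : Adversary n) (coin : ℕ → Bool) : Prop where
  aux_received : ∀ k, ∀ m ∈ (run I adv coin k).auxSent, ∀ i ∉ I.faulty,
    KnowsCoinsBelow ((run I adv coin k).proc i) m.aux.round →
      ∃ k', m ∈ ((run I adv coin k').proc i).auxRecv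
  coin_received : ∀ k, ∀ x ∈ (run I adv coin k).coinSent, x.1 ∉ I.faulty → ∀ i ∉ I.faulty,
      ∃ k', x ∈ ((run I adv coin k').proc i).coinRecv
  progress : ∀ k, ∀ i ∉ I.faulty,
    (∃ P, (proceed? I coin (run I adv coin k) i P).isSome) →
      ∃ k' > k, ((run I adv coin k').proc i).phase ≠ ((run I adv coin k).proc i).phase

/-- Process `i` decides in round `R` or earlier. -/
def DecidesBy (I : Instance n) (adv : Adversary n) (coin : ℕ → Bool) (i : Fin n) (R : ℕ) : Prop :=
  ∃ k, ((run I adv coin k).proc i).decision ≠ none ∧ ((run I adv coin k).proc i).round ≤ R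

/-- The number of rounds until termination: the least `R` such that all non-faulty processes decide
in round `R` or earlier (`∞` if there is none). -/
noncomputable def terminationRound (I : Instance n) (adv : Adversary n) (coin : ℕ → Bool) : ℝ≥0∞ :=
  ⨅ (R : ℕ) (_ : ∀ i ∉ I.faulty, DecidesBy I adv coin i R), (R : ℝ≥0∞)

/-- When the coin of round `s ≥ 1` is revealed, its output puts the system into a state from which
decision is guaranteed: however the execution continues from that moment, whatever the adversary
does and whatever the later coins are, every non-faulty process decides by the next round whose
coin has the same value as that of round `s`. -/
def GuaranteedAt (I : Instance n) (adv : Adversary n) (coin : ℕ → Bool) (s : ℕ) : Prop :=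
  1 ≤ s ∧ ∃ k, IsLeast {k | Revealed I (run I adv coin k) s} k ∧
    ∀ (adv' : Adversary n) (coin' : ℕ → Bool),
      (∀ j ≤ k, run I adv' coin' j = run I adv coin j) →
      (∀ r ≤ s, coin' r = coin r) →
      Admissible I adv' coin' →
      ∀ r > s, coin' r = coin s → ∀ i ∉ I.faulty, DecidesBy I adv' coin' i r

/-- The first round whose coin puts the system into a state from which decision is guaranteed
(`∞` if there is none). -/
noncomputable def guaranteeRound (I : Instance n) (adv : Adversary n) (coin : ℕ → Bool) : ℝ≥0∞ :=
  ⨅ (s : ℕ) (_ : GuaranteedAt I adv coin s), (s : ℝ≥0∞)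

/-- The law of the coin: the outputs in the different rounds are independent fair bits. -/
noncomputable def coinLaw : Measure (ℕ → Bool) :=
  Measure.infinitePi (fun _ : ℕ => (PMF.uniformOfFintype Bool).toMeasure)

end BBC

/-!
The coin of round `s` *locks* the value `b = coin s` if at least `t + 1` non-faulty processes never
sign `AUX[s](!b)`. Then fewer than `n - t` processes ever sign `AUX[s](!b)`, so `!b` cannot be
proved valid in any round after `s` up to and including the next round whose coin is again `b`: the
proofs for `!b` have to come from the last round with coin `b`, which is `s`. In that next round all
valid messages carry `b`, and all non-faulty processes decide (`Admissible.decidesBy_of_lock`). That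
they get there at all is `Admissible.reaches`: the estimate of a process can always be proved valid by
messages that the process has stored, so a non-faulty process never waits in vain.

Consider the moment at which the coin of round `r` is revealed. By then at least `n - 2t ≥ t + 1`
non-faulty processes have received `n - t` messages of round `r`. If some value `b` has been signed
in round `r` by `t + 1` non-faulty processes, then decision is guaranteed at round `r` provided the
coin is `b`, since a non-faulty process signs only one value per round
(`guaranteedAt_of_votes`). Otherwise no non-faulty process has seen a quorum for
one value (`exists_undecided`); so at least `t + 1` non-faulty processes adopt the coin of round `r`, and
decision is guaranteed at round `r + 1` provided its coin is the same
(`guaranteedAt_succ_of_undecided`). The execution up to that moment does not depend on the coins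
from round `r` on (`runAux_congr`), so in both cases the required coincidence has probability `1/2`,
given any event about the coins before round `r` (`half_le_guaranteed`).

Hence the probability that decision is guaranteed at none of the first `2j` rounds is at most
`2⁻ʲ`, which gives the expectation `4`. After the guarantee, the number of rounds until its coin is
repeated is geometrically distributed with mean `2`, which gives `6`.
-/

namespace BBC

variable {n : ℕ}

/-! ### Signed messages and the validity predicate -/

lemma mem_signers {S : Finset (Aux n)} {r : ℕ} {b : Bool} {i : Fin n} :
    i ∈ signers S r b ↔ (⟨i, r, b⟩ : Aux n) ∈ S := by
  simp only [signers, Finset.mem_image, Finset.mem_filter]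
  constructor
  · rintro ⟨⟨j, r', b'⟩, ⟨h, rfl, rfl⟩, rfl⟩
    exact h
  · intro h
    exact ⟨_, ⟨h, rfl, rfl⟩, rfl⟩

lemma mem_senders {S : Finset (Aux n)} {r : ℕ} {i : Fin n} :
    i ∈ senders S r ↔ ∃ b, (⟨i, r, b⟩ : Aux n) ∈ S := by
  simp only [senders, Finset.mem_image, Finset.mem_filter]
  constructor
  · rintro ⟨⟨j, r', b'⟩, ⟨h, rfl⟩, rfl⟩
    exact ⟨b', h⟩
  · rintro ⟨b, h⟩
    exact ⟨_, ⟨h, rfl⟩, rfl⟩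

lemma signers_mono {S T : Finset (Aux n)} (h : S ⊆ T) (r : ℕ) (b : Bool) :
    signers S r b ⊆ signers T r b :=
  fun _ hi => mem_signers.2 (h (mem_signers.1 hi))

lemma senders_mono {S T : Finset (Aux n)} (h : S ⊆ T) (r : ℕ) :
    senders S r ⊆ senders T r := fun _ hi => by
  obtain ⟨b, hb⟩ := mem_senders.1 hi
  exact mem_senders.2 ⟨b, h hb⟩

lemma senders_subset_signers {S : Finset (Aux n)} {r : ℕ} {b : Bool}
    (h : ∀ a ∈ S, a.round = r → a.val = b) : senders S r ⊆ signers S r b := fun i hi => by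
  obtain ⟨b', hb⟩ := mem_senders.1 hi
  obtain rfl : b' = b := h _ hb rfl
  exact mem_signers.2 hb

lemma senders_subset_union (S : Finset (Aux n)) (r : ℕ) :
    senders S r ⊆ signers S r false ∪ signers S r true := fun i hi => by
  obtain ⟨b, hb⟩ := mem_senders.1 hi
  cases b
  · exact Finset.mem_union_left _ (mem_signers.2 hb)
  · exact Finset.mem_union_right _ (mem_signers.2 hb)

lemma prevRound_congr {m m' : ℕ → Option Bool} {r : ℕ} (h : ∀ r' < r, m r' = m' r') (v : Bool) :
    prevRound m r v = prevRound m' r v := by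
  unfold prevRound
  congr 1
  refine Finset.filter_congr fun r' hr' => ?_
  rw [h r' (Finset.mem_range.1 hr')]

lemma prevRound_succ_of_eq {m : ℕ → Option Bool} {r : ℕ} {v : Bool} (h : m r = some (!v)) :
    prevRound m (r + 1) v = r := by
  unfold prevRound
  rw [Finset.range_add_one, Finset.filter_insert, if_pos h, Finset.sup_insert]
  refine sup_eq_left.2 (Finset.sup_le fun x hx => ?_)
  exact (Finset.mem_range.1 (Finset.mem_filter.1 hx).1).le

lemma prevRound_succ_of_ne {m : ℕ → Option Bool} {r : ℕ} {v : Bool} (h : m r ≠ some (!v)) :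
    prevRound m (r + 1) v = prevRound m r v := by
  unfold prevRound
  rw [Finset.range_add_one, Finset.filter_insert, if_neg h]

lemma prevRound_one (m : ℕ → Option Bool) (v : Bool) : prevRound m 1 v = 0 := by
  by_cases h : m 0 = some (!v)
  · exact prevRound_succ_of_eq h
  · rw [prevRound_succ_of_ne h]
    simp [prevRound]

lemma prevRound_spec (m : ℕ → Option Bool) (r : ℕ) (v : Bool) :
    prevRound m r v = 0 ∨ m (prevRound m r v) = some (!v) ∧ prevRound m r v < r := by
  induction r with
  | zero => simp [prevRound]
  | succ r ih =>
    by_cases h : m r = some (!v)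
    · rw [prevRound_succ_of_eq h]
      exact Or.inr ⟨h, r.lt_succ_self⟩
    · rw [prevRound_succ_of_ne h]
      exact ih.imp_right fun h' => ⟨h'.1, h'.2.trans r.lt_succ_self⟩

lemma prevRound_eq_of_gap {m : ℕ → Option Bool} {s q : ℕ} {v : Bool} (hs : m s = some (!v))
    (hsq : s < q) (hgap : ∀ p, s < p → p < q → m p ≠ some (!v)) : prevRound m q v = s := by
  induction q, hsq using Nat.le_induction with
  | base => exact prevRound_succ_of_eq hs
  | succ q hq ih =>
    rw [prevRound_succ_of_ne (hgap q hq q.lt_succ_self)]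
    exact ih fun p hp hpq => hgap p hp (hpq.trans q.lt_succ_self)

lemma isValid_congr {t : ℕ} {m m' : ℕ → Option Bool} {r : ℕ} (h : ∀ r' < r, m r' = m' r')
    (v : Bool) (P : Finset (Aux n)) : IsValid t m r v P ↔ IsValid t m' r v P := by
  unfold IsValid
  rw [prevRound_congr h]

lemma IsValid.mono {t : ℕ} {m : ℕ → Option Bool} {r : ℕ} {v : Bool} {P Q : Finset (Aux n)}
    (h : IsValid t m r v P) (hPQ : P ⊆ Q) : IsValid t m r v Q := by
  have hc : ∀ r', (signers P r' v).card ≤ (signers Q r' v).card :=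
    fun r' => Finset.card_le_card (signers_mono hPQ r' v)
  unfold IsValid at h ⊢
  split_ifs at h ⊢ with h0 h1
  · exact h.trans (hc _)
  · exact h.imp (fun h' => ⟨h'.1, h'.2.trans (hc _)⟩) (fun h' => h'.trans (hc _))

lemma isValid_zero {t : ℕ} {m : ℕ → Option Bool} {v : Bool} {P : Finset (Aux n)} :
    IsValid t m 0 v P := by
  simp [IsValid]

lemma isValid_one {t : ℕ} {m : ℕ → Option Bool} {v : Bool} {P : Finset (Aux n)} :
    IsValid t m 1 v P ↔ t + 1 ≤ (signers P 0 v).card := by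
  simp [IsValid]

/-- Validity survives a round whose coin agrees with the value. -/
lemma IsValid.succ_of_coin_eq {t : ℕ} {m : ℕ → Option Bool} {r : ℕ} {v : Bool}
    {P : Finset (Aux n)} (h : IsValid t m r v P) (hr : 1 ≤ r) (hm : m r = some v) :
    IsValid t m (r + 1) v P := by
  have hp : prevRound m (r + 1) v = prevRound m r v :=
    prevRound_succ_of_ne (by rw [hm]; cases v <;> simp)
  unfold IsValid at h ⊢
  rw [if_neg (by omega), if_neg (by omega), hp]
  rw [if_neg (by omega)] at h
  split_ifs at h with h1
  · subst h1
    exact Or.inl ⟨prevRound_one m v, h⟩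
  · exact h

/-- A quorum for `v` makes `v` valid after a round whose coin disagrees with `v`. -/
lemma isValid_succ_of_coin_ne {t : ℕ} {m : ℕ → Option Bool} {r : ℕ} {v : Bool}
    {P : Finset (Aux n)} (hr : 1 ≤ r) (hm : m r = some (!v))
    (h : n - t ≤ (signers P r v).card) : IsValid t m (r + 1) v P := by
  unfold IsValid
  rw [if_neg (by omega), if_neg (by omega), prevRound_succ_of_eq hm]
  exact Or.inr h

/-- A minimal proving set consists of round `0` messages, or of messages whose value the coin of
their own round contradicts. -/
lemma round_of_mem_minimal {t : ℕ} {m : ℕ → Option Bool} {r : ℕ} {v : Bool}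
    {K : Finset (Aux n)} (h : IsValid t m r v K)
    (hmin : ∀ a ∈ K, ¬ IsValid t m r v (K.erase a)) {a : Aux n} (ha : a ∈ K) :
    a.round = 0 ∨ a.round < r ∧ m a.round = some (!a.val) := by
  by_contra! hcon
  obtain ⟨h0, hne⟩ := hcon
  have hsub : ∀ q, a.round ≠ q ∨ a.val ≠ v → signers K q v ⊆ signers (K.erase a) q v := by
    intro q hq i hi
    rw [mem_signers] at hi ⊢
    refine Finset.mem_erase.2 ⟨?_, hi⟩
    rintro rfl
    simp at hq
  refine hmin a ha ?_
  have hz := Finset.card_le_card (hsub 0 (Or.inl h0))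
  unfold IsValid at h ⊢
  split_ifs at h ⊢ with h1 h2
  · exact h.trans hz
  · refine h.imp (fun h' => ⟨h'.1, h'.2.trans hz⟩) fun h' => h'.trans (Finset.card_le_card ?_)
    refine hsub _ ?_
    by_contra! hc
    rcases prevRound_spec m r v with hp | hp
    · exact h0 (hc.1.trans hp)
    · rw [← hc.1, ← hc.2] at hp
      exact hne hp.2 hp.1

/-! ### Single steps of an execution -/

/-- `LocalStep I coin σ i p' S C`: in configuration `σ`, one action can take process `i` to the
local state `p'`, with `S` and `C` the sets of sent AUX and COIN messages afterwards. -/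
inductive LocalStep (I : Instance n) (coin : ℕ → Bool) (σ : Config n) (i : Fin n) :
    Local n → Finset (AuxProof n) → Finset (Fin n × ℕ) → Prop
  | reject (m : AuxProof n) (hk : KnowsCoinsBelow (σ.proc i) m.aux.round)
      (hv : ¬ IsValid I.t (σ.proc i).coinMap m.aux.round m.aux.val m.proofs) :
      LocalStep I coin σ i { σ.proc i with auxRecv := insert m (σ.proc i).auxRecv }
        σ.auxSent σ.coinSent
  | accept (m : AuxProof n) (kept : Finset (Aux n))
      (ha : Authentic I σ m.aux) (hp : ∀ a ∈ m.proofs, Authentic I σ a)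
      (hk : KnowsCoinsBelow (σ.proc i) m.aux.round) (hsub : kept ⊆ m.proofs)
      (hv : IsValid I.t (σ.proc i).coinMap m.aux.round m.aux.val kept)
      (hmin : ∀ a ∈ kept, ¬ IsValid I.t (σ.proc i).coinMap m.aux.round m.aux.val (kept.erase a)) :
      LocalStep I coin σ i { σ.proc i with
          auxRecv := insert m (σ.proc i).auxRecv
          auxValues := insert m.aux ((σ.proc i).auxValues ∪ kept) } σ.auxSent σ.coinSent
  | recvCoin (x : Fin n × ℕ) (hx : x ∈ σ.coinSent) :
      LocalStep I coin σ i { σ.proc i with coinRecv := insert x (σ.proc i).coinRecv }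
        σ.auxSent σ.coinSent
  | start (hph : (σ.proc i).phase = .start) :
      LocalStep I coin σ i { σ.proc i with phase := .waitInit }
        (insert ⟨⟨i, 0, I.proposal i⟩, ∅⟩ σ.auxSent) σ.coinSent
  | init (hph : (σ.proc i).phase = .waitInit)
      (hq : n - I.t ≤ (senders (σ.proc i).auxValues 0).card) :
      LocalStep I coin σ i { σ.proc i with
          est := if I.t + 1 ≤ (signers (σ.proc i).auxValues 0 false).card
            then some false else some true
          phase := .nextRound } σ.auxSent σ.coinSent
  | enter (hph : (σ.proc i).phase = .nextRound) (v : Bool) (P : Finset (Aux n))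
      (hest : (σ.proc i).est = some v) (hP : P ⊆ (σ.proc i).auxValues)
      (hv : IsValid I.t (σ.proc i).coinMap ((σ.proc i).round + 1) v P) :
      LocalStep I coin σ i { σ.proc i with round := (σ.proc i).round + 1, phase := .waitAux }
        (insert ⟨⟨i, (σ.proc i).round + 1, v⟩, P⟩ σ.auxSent) σ.coinSent
  | estimate (hph : (σ.proc i).phase = .waitAux)
      (hq : n - I.t ≤ (senders (σ.proc i).auxValues (σ.proc i).round).card) :
      LocalStep I coin σ i { σ.proc i with
          est := if n - I.t ≤ (signers (σ.proc i).auxValues (σ.proc i).round true).card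
            then some true
            else if n - I.t ≤ (signers (σ.proc i).auxValues (σ.proc i).round false).card
            then some false else none
          phase := .waitCoin } σ.auxSent (insert (i, (σ.proc i).round) σ.coinSent)
  | learn (hph : (σ.proc i).phase = .waitCoin)
      (hq : n - I.t ≤ (((σ.proc i).coinRecv.filter
        (fun x => x.2 = (σ.proc i).round)).image Prod.fst).card) :
      LocalStep I coin σ i { σ.proc i with
          coinMap := Function.update (σ.proc i).coinMap (σ.proc i).round
            (some (coin (σ.proc i).round))
          phase := .coinKnown } σ.auxSent σ.coinSent
  | finish (hph : (σ.proc i).phase = .coinKnown) (b : Bool)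
      (hb : (σ.proc i).coinMap (σ.proc i).round = some b) :
      LocalStep I coin σ i { σ.proc i with
          decision := if (σ.proc i).decision = none ∧
              n - I.t ≤ (signers (σ.proc i).auxValues (σ.proc i).round b).card
            then some b else (σ.proc i).decision
          est := if (σ.proc i).est = none then some b else (σ.proc i).est
          phase := .nextRound } σ.auxSent σ.coinSent

/-- The possible effects of one action: nothing, a faulty signature on a COIN message, or a step
of one non-faulty process. -/
inductive Trans (I : Instance n) (coin : ℕ → Bool) (σ : Config n) : Config n → Prop
  | idle : Trans I coin σ σ
  | signCoin (j : Fin n) (r : ℕ) (hj : j ∈ I.faulty) :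
      Trans I coin σ { σ with coinSent := insert (j, r) σ.coinSent }
  | step (i : Fin n) (hi : i ∉ I.faulty) (p' : Local n) (S : Finset (AuxProof n))
      (C : Finset (Fin n × ℕ)) (h : LocalStep I coin σ i p' S C) :
      Trans I coin σ ⟨Function.update σ.proc i p', S, C⟩

lemma proceed?_localStep {I : Instance n} {coin : ℕ → Bool} {σ σ' : Config n} {i : Fin n}
    {P : Finset (Aux n)} (h : proceed? I coin σ i P = some σ') :
    ∃ p' S C, LocalStep I coin σ i p' S C ∧ σ' = ⟨Function.update σ.proc i p', S, C⟩ := by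
  unfold proceed? at h
  simp only at h
  split at h
  next hph =>
    obtain rfl := Option.some.inj h
    exact ⟨_, _, _, .start hph, rfl⟩
  next hph =>
    obtain ⟨hq, h⟩ := Option.ite_none_right_eq_some.1 h
    obtain rfl := Option.some.inj h
    exact ⟨_, _, _, .init hph hq, rfl⟩
  next hph =>
    split at h
    · cases h
    next v hest =>
      split_ifs at h with hq
      obtain rfl := Option.some.inj h
      exact ⟨_, _, _, .enter hph v P hest hq.1 hq.2, rfl⟩
  next hph =>
    obtain ⟨hq, h⟩ := Option.ite_none_right_eq_some.1 h
    obtain rfl := Option.some.inj h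
    exact ⟨_, _, _, .estimate hph hq, rfl⟩
  next hph =>
    obtain ⟨hq, h⟩ := Option.ite_none_right_eq_some.1 h
    obtain rfl := Option.some.inj h
    exact ⟨_, _, _, .learn hph hq, rfl⟩
  next hph =>
    split at h
    · cases h
    next b hb =>
      obtain rfl := Option.some.inj h
      exact ⟨_, _, _, .finish hph b hb, rfl⟩

lemma step_trans (I : Instance n) (coin : ℕ → Bool) (σ : Config n) (a : Action n) :
    Trans I coin σ (step I coin σ a) := by
  cases a with
  | deliverAux i m kept =>
    simp only [step]
    split_ifs with h1 h2 h3
    · exact .step i h1.1 _ _ _ (.accept m kept h1.2.1 h1.2.2.1 h1.2.2.2 h3.1 h3.2.1 h3.2.2)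
    · exact .idle
    · exact .step i h1.1 _ _ _ (.reject m h1.2.2.2 h2)
    · exact .idle
  | deliverCoin i j r =>
    simp only [step]
    split_ifs with h
    · exact .step i h.1 _ _ _ (.recvCoin (j, r) h.2)
    · exact .idle
  | signCoin j r =>
    simp only [step]
    split_ifs with h
    · exact .signCoin j r h
    · exact .idle
  | proceed i P =>
    simp only [step]
    split_ifs with h
    · exact .idle
    · cases hp : proceed? I coin σ i P with
      | none => exact .idle
      | some σ' =>
        obtain ⟨p', S, C, hl, rfl⟩ := proceed?_localStep hp
        exact .step i h _ _ _ hl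

lemma run_zero (I : Instance n) (adv : Adversary n) (coin : ℕ → Bool) :
    run I adv coin 0 = Config.initial n := rfl

lemma run_succ_trans (I : Instance n) (adv : Adversary n) (coin : ℕ → Bool) (k : ℕ) :
    Trans I coin (run I adv coin k) (run I adv coin (k + 1)) :=
  step_trans I coin _ _

/-- The place of a phase within its round. -/
def Phase.idx : Phase → ℕ
  | .start => 0
  | .waitInit => 1
  | .waitAux => 1
  | .waitCoin => 2
  | .coinKnown => 3
  | .nextRound => 4

/-- The progress of a process in its program: it never decreases, and it grows whenever the main
program makes a step. The first two phases share the round `0` with the first entry into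
`nextRound`, so that `pos` skips the values `2` and `3`. -/
def Local.pos (p : Local n) : ℕ := 4 * p.round + p.phase.idx

namespace LocalStep

variable {I : Instance n} {coin : ℕ → Bool} {σ : Config n} {i : Fin n} {p' : Local n}
  {S : Finset (AuxProof n)} {C : Finset (Fin n × ℕ)}

lemma auxSent_subset (h : LocalStep I coin σ i p' S C) : σ.auxSent ⊆ S := by
  cases h <;> first | exact Finset.Subset.refl _ | exact Finset.subset_insert _ _

lemma coinSent_subset (h : LocalStep I coin σ i p' S C) : σ.coinSent ⊆ C := by
  cases h <;> first | exact Finset.Subset.refl _ | exact Finset.subset_insert _ _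

lemma signer_of_new (h : LocalStep I coin σ i p' S C) {m : AuxProof n} (hm : m ∈ S)
    (hne : m.aux.signer ≠ i) : m ∈ σ.auxSent := by
  cases h <;> first
    | exact hm
    | · rcases Finset.mem_insert.1 hm with rfl | hm
        · exact absurd rfl hne
        · exact hm

lemma coin_signer_of_new (h : LocalStep I coin σ i p' S C) {x : Fin n × ℕ} (hx : x ∈ C)
    (hne : x.1 ≠ i) : x ∈ σ.coinSent := by
  cases h <;> first
    | exact hx
    | · rcases Finset.mem_insert.1 hx with rfl | hx
        · exact absurd rfl hne
        · exact hx

lemma auxValues_subset (h : LocalStep I coin σ i p' S C) :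
    (σ.proc i).auxValues ⊆ p'.auxValues := by
  cases h <;> first
    | exact Finset.Subset.refl _
    | exact Finset.subset_union_left.trans (Finset.subset_insert _ _)

lemma coinRecv_subset (h : LocalStep I coin σ i p' S C) : (σ.proc i).coinRecv ⊆ p'.coinRecv := by
  cases h <;> first | exact Finset.Subset.refl _ | exact Finset.subset_insert _ _

lemma pos_cases (h : LocalStep I coin σ i p' S C) :
    (p'.phase = (σ.proc i).phase ∧ p'.round = (σ.proc i).round) ∨
      (σ.proc i).pos < p'.pos ∧
        (p'.pos = (σ.proc i).pos + 1 ∨ (σ.proc i).phase = .waitInit ∧ p'.phase = .nextRound ∧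
          p'.round = (σ.proc i).round) := by
  cases h <;> first
    | exact Or.inl ⟨rfl, rfl⟩
    | · rename_i hph _
        right
        simp [Local.pos, hph, Phase.idx]
    | · rename_i hph _ _ _ _ _
        right
        simp only [Local.pos, hph, Phase.idx]
        omega
    | · rename_i hph _ _
        right
        simp [Local.pos, hph, Phase.idx]
    | · rename_i hph
        right
        simp [Local.pos, hph, Phase.idx]

end LocalStep

namespace Trans

variable {I : Instance n} {coin : ℕ → Bool} {σ σ' : Config n}

lemma auxSent_subset (h : Trans I coin σ σ') : σ.auxSent ⊆ σ'.auxSent := by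
  cases h with
  | idle => exact Finset.Subset.refl _
  | signCoin j r hj => exact Finset.Subset.refl _
  | step i hi p' S C h => exact h.auxSent_subset

/-- A step changes the local state of a process only by a local step of that process. -/
lemma proc_cases (h : Trans I coin σ σ') (j : Fin n) :
    (σ'.proc j = σ.proc j ∧ ∀ m ∈ σ'.auxSent, m.aux.signer = j → m ∈ σ.auxSent) ∨
      LocalStep I coin σ j (σ'.proc j) σ'.auxSent σ'.coinSent := by
  cases h with
  | idle => exact Or.inl ⟨rfl, fun m hm _ => hm⟩
  | signCoin i r hi => exact Or.inl ⟨rfl, fun m hm _ => hm⟩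
  | step i hi p' S C h =>
    by_cases hij : j = i
    · subst hij
      right
      simpa using h
    · left
      refine ⟨by simp [hij], fun m hm hmj => h.signer_of_new hm ?_⟩
      rw [hmj]
      exact hij

lemma auxValues_subset (h : Trans I coin σ σ') (j : Fin n) :
    (σ.proc j).auxValues ⊆ (σ'.proc j).auxValues := by
  rcases h.proc_cases j with h | h
  · rw [h.1]
  · exact h.auxValues_subset

lemma coinRecv_subset (h : Trans I coin σ σ') (j : Fin n) :
    (σ.proc j).coinRecv ⊆ (σ'.proc j).coinRecv := by
  rcases h.proc_cases j with h | h
  · rw [h.1]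
  · exact h.coinRecv_subset

lemma pos_cases (h : Trans I coin σ σ') (j : Fin n) :
    ((σ'.proc j).phase = (σ.proc j).phase ∧ (σ'.proc j).round = (σ.proc j).round) ∨
      (σ.proc j).pos < (σ'.proc j).pos ∧
        ((σ'.proc j).pos = (σ.proc j).pos + 1 ∨ (σ.proc j).phase = .waitInit ∧
          (σ'.proc j).phase = .nextRound ∧ (σ'.proc j).round = (σ.proc j).round) := by
  rcases h.proc_cases j with h | h
  · rw [h.1]
    simp
  · exact h.pos_cases

lemma pos_le (h : Trans I coin σ σ') (j : Fin n) : (σ.proc j).pos ≤ (σ'.proc j).pos := by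
  rcases h.pos_cases j with h | h
  · simp [Local.pos, h.1, h.2]
  · exact h.1.le

end Trans

lemma Authentic.mono {I : Instance n} {σ σ' : Config n} {a : Aux n} (h : Authentic I σ a)
    (hs : σ.auxSent ⊆ σ'.auxSent) : Authentic I σ' a :=
  h.imp_right fun h => Finset.image_subset_image hs h

lemma Revealed.mono {I : Instance n} {σ σ' : Config n} {r : ℕ} (h : Revealed I σ r)
    (hs : σ.coinSent ⊆ σ'.coinSent) : Revealed I σ' r :=
  le_trans h (Finset.card_le_card (Finset.image_subset_image (Finset.filter_subset_filter _ hs)))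

/-! ### Invariants -/

/-- The coin outputs as a process that knew all of them would record them; round `0` has no
coin. -/
def fullMap (coin : ℕ → Bool) : ℕ → Option Bool := fun r => if r = 0 then none else some (coin r)

/-- The invariant of a non-faulty process `i` with local state `p` in configuration `σ`. The
position in the program determines which messages the process has signed and which coins it knows.
Every stored AUX message is either proved valid by other stored messages, or it is part of a stored
proof and contradicts the coin of its round, which the process then knows already. The estimate can
always be proved valid. -/
structure LocalInv (I : Instance n) (coin : ℕ → Bool) (σ : Config n) (i : Fin n)
    (p : Local n) : Prop where
  round_zero : p.phase = .start ∨ p.phase = .waitInit → p.round = 0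
  round_pos : p.phase = .waitAux ∨ p.phase = .waitCoin ∨ p.phase = .coinKnown → 1 ≤ p.round
  coinMap_eq : ∀ r, p.coinMap r = if 1 ≤ r ∧ 4 * r + 3 ≤ p.pos then some (coin r) else none
  coinRecv_sub : p.coinRecv ⊆ σ.coinSent
  revealed : ∀ r, 1 ≤ r → 4 * r + 3 ≤ p.pos → Revealed I σ r
  sent_pos : ∀ m ∈ σ.auxSent, m.aux.signer = i → 4 * m.aux.round + 1 ≤ p.pos
  pos_sent : ∀ r, 4 * r + 1 ≤ p.pos → ∃ m ∈ σ.auxSent, m.aux.signer = i ∧ m.aux.round = r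
  coin_pos : ∀ r, (i, r) ∈ σ.coinSent → 1 ≤ r ∧ 4 * r + 2 ≤ p.pos
  pos_coin : ∀ r, 1 ≤ r → 4 * r + 2 ≤ p.pos → (i, r) ∈ σ.coinSent
  authentic : ∀ a ∈ p.auxValues, Authentic I σ a
  recv : ∀ m ∈ p.auxRecv, IsValid I.t (fullMap coin) m.aux.round m.aux.val m.proofs →
    m.aux ∈ p.auxValues
  aux_valid : ∀ a ∈ p.auxValues, IsValid I.t (fullMap coin) a.round a.val p.auxValues ∨
    1 ≤ a.round ∧ 4 * a.round + 3 ≤ p.pos ∧ coin a.round = !a.val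
  est_next : p.phase = .nextRound → ∃ v, p.est = some v ∧
    IsValid I.t (fullMap coin) (p.round + 1) v p.auxValues
  est_coin : p.phase = .waitCoin ∨ p.phase = .coinKnown →
    (∀ b, p.est = some b → n - I.t ≤ (signers p.auxValues p.round b).card ∧
      IsValid I.t (fullMap coin) p.round b p.auxValues) ∧
    (p.est = none → ∀ b, IsValid I.t (fullMap coin) p.round b p.auxValues)

/-- The invariant of all configurations of an execution. -/
structure Inv (I : Instance n) (coin : ℕ → Bool) (σ : Config n) : Prop where
  loc : ∀ i ∉ I.faulty, LocalInv I coin σ i (σ.proc i)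
  sent_valid : ∀ m ∈ σ.auxSent, IsValid I.t (fullMap coin) m.aux.round m.aux.val m.proofs
  sent_good : ∀ m ∈ σ.auxSent, m.aux.signer ∉ I.faulty
  sent_unique : ∀ m ∈ σ.auxSent, ∀ m' ∈ σ.auxSent, m.aux.signer = m'.aux.signer →
    m.aux.round = m'.aux.round → m.aux.val = m'.aux.val

section Invariants

variable {I : Instance n} {coin : ℕ → Bool} {σ σ' : Config n}

lemma LocalInv.frame {i : Fin n} {p : Local n} (h : LocalInv I coin σ i p)
    (hS : σ.auxSent ⊆ σ'.auxSent) (hC : σ.coinSent ⊆ σ'.coinSent)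
    (hS' : ∀ m ∈ σ'.auxSent, m.aux.signer = i → m ∈ σ.auxSent)
    (hC' : ∀ x ∈ σ'.coinSent, x.1 = i → x ∈ σ.coinSent) : LocalInv I coin σ' i p where
  round_zero := h.round_zero
  round_pos := h.round_pos
  coinMap_eq := h.coinMap_eq
  coinRecv_sub := h.coinRecv_sub.trans hC
  revealed r h1 h2 := (h.revealed r h1 h2).mono hC
  sent_pos m hm hi := h.sent_pos m (hS' m hm hi) hi
  pos_sent r hr := by
    obtain ⟨m, hm, h'⟩ := h.pos_sent r hr
    exact ⟨m, hS hm, h'⟩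
  coin_pos r hr := h.coin_pos r (hC' _ hr rfl)
  pos_coin r h1 h2 := hC (h.pos_coin r h1 h2)
  authentic a ha := (h.authentic a ha).mono hS
  recv := h.recv
  aux_valid := h.aux_valid
  est_next := h.est_next
  est_coin := h.est_coin

lemma LocalInv.coinMap_eq_fullMap {i : Fin n} {p : Local n} (h : LocalInv I coin σ i p) {r : ℕ}
    (hk : KnowsCoinsBelow p r) : ∀ r' < r, p.coinMap r' = fullMap coin r' := by
  intro r' hr'
  by_cases h0 : r' = 0
  · rw [h.coinMap_eq]
    simp [h0, fullMap]
  · have := hk r' (Finset.mem_Ico.2 ⟨by omega, hr'⟩)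
    rw [h.coinMap_eq] at this ⊢
    split_ifs at this ⊢
    · simp [fullMap, h0]
    · exact absurd rfl this

lemma LocalInv.isValid_iff {i : Fin n} {p : Local n} (h : LocalInv I coin σ i p) {r : ℕ}
    (hk : KnowsCoinsBelow p r) (v : Bool) (P : Finset (Aux n)) :
    IsValid I.t p.coinMap r v P ↔ IsValid I.t (fullMap coin) r v P :=
  isValid_congr (h.coinMap_eq_fullMap hk) v P

lemma LocalInv.knowsCoinsBelow {i : Fin n} {p : Local n} (h : LocalInv I coin σ i p) {r : ℕ}
    (hr : 4 * r ≤ p.pos + 1) : KnowsCoinsBelow p r := by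
  intro r' hr'
  obtain ⟨h1, h2⟩ := Finset.mem_Ico.1 hr'
  rw [h.coinMap_eq, if_pos ⟨h1, by omega⟩]
  simp

end Invariants

section Preservation

variable {I : Instance n} {coin : ℕ → Bool} {σ σ' : Config n} {i : Fin n} {p : Local n}

lemma LocalInv.coin_eq (h : LocalInv I coin σ i p) {r : ℕ} {c : Bool}
    (hc : p.coinMap r = some c) : 1 ≤ r ∧ 4 * r + 3 ≤ p.pos ∧ c = coin r := by
  rw [h.coinMap_eq] at hc
  split_ifs at hc with h1
  exact ⟨h1.1, h1.2, (Option.some.inj hc).symm⟩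

lemma LocalInv.isValid_of_mem_waiting (h : LocalInv I coin σ i p) {a : Aux n}
    (ha : a ∈ p.auxValues) (hpos : p.pos < 4 * a.round + 3) :
    IsValid I.t (fullMap coin) a.round a.val p.auxValues :=
  (h.aux_valid a ha).resolve_right fun h' => absurd h'.2.1 (by omega)

lemma LocalInv.accept (h : LocalInv I coin σ i p) {m : AuxProof n} {kept : Finset (Aux n)}
    (ha : Authentic I σ m.aux) (hp : ∀ a ∈ m.proofs, Authentic I σ a)
    (hk : KnowsCoinsBelow p m.aux.round) (hsub : kept ⊆ m.proofs)
    (hv : IsValid I.t p.coinMap m.aux.round m.aux.val kept)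
    (hmin : ∀ a ∈ kept, ¬ IsValid I.t p.coinMap m.aux.round m.aux.val (kept.erase a)) :
    LocalInv I coin σ i { p with
      auxRecv := insert m p.auxRecv
      auxValues := insert m.aux (p.auxValues ∪ kept) } := by
  have hA : p.auxValues ⊆ insert m.aux (p.auxValues ∪ kept) :=
    Finset.subset_union_left.trans (Finset.subset_insert _ _)
  have hK : kept ⊆ insert m.aux (p.auxValues ∪ kept) :=
    Finset.subset_union_right.trans (Finset.subset_insert _ _)
  refine { h with
    authentic := ?_, recv := ?_, aux_valid := ?_, est_next := ?_, est_coin := ?_ }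
  · intro a ha'
    rcases Finset.mem_insert.1 ha' with rfl | ha'
    · exact ha
    · rcases Finset.mem_union.1 ha' with ha' | ha'
      · exact h.authentic a ha'
      · exact hp a (hsub ha')
  · intro m' hm' hv'
    rcases Finset.mem_insert.1 hm' with rfl | hm'
    · exact Finset.mem_insert_self _ _
    · exact hA (h.recv m' hm' hv')
  · intro a ha'
    rcases Finset.mem_insert.1 ha' with rfl | ha'
    · exact Or.inl (((h.isValid_iff hk _ _).1 hv).mono hK)
    · rcases Finset.mem_union.1 ha' with ha' | ha'
      · exact (h.aux_valid a ha').imp_left fun h' => h'.mono hA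
      · rcases round_of_mem_minimal hv hmin ha' with h0 | ⟨_, h0⟩
        · left
          rw [h0]
          exact isValid_zero
        · obtain ⟨h1, h2, h3⟩ := h.coin_eq h0
          exact Or.inr ⟨h1, h2, h3.symm⟩
  · intro hph
    obtain ⟨v, hv, hval⟩ := h.est_next hph
    exact ⟨v, hv, hval.mono hA⟩
  · intro hph
    obtain ⟨h1, h2⟩ := h.est_coin hph
    refine ⟨fun b hb => ⟨(h1 b hb).1.trans (Finset.card_le_card (signers_mono hA _ _)),
      (h1 b hb).2.mono hA⟩, fun hn b => (h2 hn b).mono hA⟩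

lemma exists_mem_signers_of_quorum {A : Finset (Aux n)} {t r : ℕ} {b : Bool} (hn : 0 < n - t)
    (h : n - t ≤ (signers A r b).card) : ∃ j, (⟨j, r, b⟩ : Aux n) ∈ A := by
  obtain ⟨j, hj⟩ := Finset.card_pos.1 (hn.trans_le h)
  exact ⟨j, mem_signers.1 hj⟩

/-- A quorum of senders without a quorum of signers for `!b` contains a message for `b`. -/
lemma exists_mem_of_senders {A : Finset (Aux n)} {t r : ℕ} (b : Bool)
    (h : n - t ≤ (senders A r).card) (hb : ¬ n - t ≤ (signers A r (!b)).card) :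
    ∃ j, (⟨j, r, b⟩ : Aux n) ∈ A := by
  by_contra! hcon
  refine hb (h.trans (Finset.card_le_card (senders_subset_signers fun a ha har => ?_)))
  by_contra hne
  refine hcon a.signer ?_
  have hv : a.val = b := by
    cases b <;> cases hav : a.val <;> simp_all
  rw [← har, ← hv]
  exact ha

lemma LocalStep.localInv {p' : Local n} {S : Finset (AuxProof n)} {C : Finset (Fin n × ℕ)}
    (hs : LocalStep I coin σ i p' S C) (h : LocalInv I coin σ i (σ.proc i)) (ht : 3 * I.t < n)
    (f : Fin n → Local n) : LocalInv I coin ⟨f, S, C⟩ i p' := by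
  have hfr : S = σ.auxSent → C = σ.coinSent → LocalInv I coin ⟨f, S, C⟩ i (σ.proc i) := by
    rintro rfl rfl
    exact h.frame (Finset.Subset.refl _) (Finset.Subset.refl _) (fun _ hm _ => hm)
      (fun _ hm _ => hm)
  generalize hp : σ.proc i = p at *
  have hpos0 : p.pos = 4 * p.round + p.phase.idx := rfl
  cases hs with
  | reject m hk hv =>
    rw [hp] at *
    have h := hfr rfl rfl
    refine { h with recv := fun m' hm' hv' => ?_ }
    rcases Finset.mem_insert.1 hm' with rfl | hm'
    · exact absurd ((h.isValid_iff hk _ _).2 hv') hv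
    · exact h.recv m' hm' hv'
  | accept m kept ha hpf hk hsub hv hmin =>
    rw [hp] at *
    exact (hfr rfl rfl).accept ha hpf hk hsub hv hmin
  | recvCoin x hx =>
    rw [hp] at *
    exact { hfr rfl rfl with coinRecv_sub := Finset.insert_subset hx h.coinRecv_sub }
  | start hph =>
    rw [hp] at *
    have hr := h.round_zero (Or.inl hph)
    rw [hph] at hpos0
    simp only [Phase.idx] at hpos0
    have hpos : ({ p with phase := Phase.waitInit } : Local n).pos = 1 := by
      simp [Local.pos, hr, Phase.idx]
    refine
      { round_zero := fun _ => hr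
        round_pos := by simp
        coinMap_eq := fun r => ?_
        coinRecv_sub := h.coinRecv_sub
        revealed := fun r h1 h2 => by rw [hpos] at h2; omega
        sent_pos := fun m hm hmi => ?_
        pos_sent := fun r hr' =>
          ⟨_, Finset.mem_insert_self _ _, rfl, by rw [hpos] at hr'; simp only; omega⟩
        coin_pos := fun r hr' => by have := h.coin_pos r hr'; omega
        pos_coin := fun r h1 h2 => by rw [hpos] at h2; omega
        authentic := fun a ha => (h.authentic a ha).mono (Finset.subset_insert _ _)
        recv := h.recv
        aux_valid := fun a ha => (h.aux_valid a ha).imp_right fun h' => by omega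
        est_next := by simp
        est_coin := by simp }
    · rw [hpos, if_neg (by omega)]
      refine (h.coinMap_eq r).trans (if_neg (by omega))
    · rcases Finset.mem_insert.1 hm with rfl | hm
      · simp [hpos]
      · have := h.sent_pos m hm hmi
        omega
  | init hph hq =>
    rw [hp] at *
    have hr := h.round_zero (Or.inr hph)
    rw [hph] at hpos0
    simp only [Phase.idx] at hpos0
    have hpos : ∀ e, ({ p with est := e, phase := Phase.nextRound } : Local n).pos = 4 := by
      simp [Local.pos, hr, Phase.idx]
    have h := hfr rfl rfl
    refine { h with
      round_zero := by simp
      round_pos := by simp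
      coinMap_eq := fun r => ?_
      revealed := fun r h1 h2 => ?_
      sent_pos := fun m hm hmi => ?_
      pos_sent := fun r hr' => ?_
      coin_pos := fun r hr' => ?_
      pos_coin := fun r h1 h2 => ?_
      aux_valid := fun a ha => (h.aux_valid a ha).imp_right fun h' => ⟨h'.1, ?_, h'.2.2⟩
      est_next := fun _ => ?_
      est_coin := by simp }
    · exact (h.coinMap_eq r).trans (if_congr (by rw [hpos]; omega) rfl rfl)
    · rw [hpos] at h2; omega
    · rw [hpos]; have := h.sent_pos m hm hmi; omega
    · rw [hpos] at hr'; exact h.pos_sent r (by omega)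
    · rw [hpos]; have := h.coin_pos r hr'; omega
    · rw [hpos] at h2; omega
    · omega
    · simp only [hr, zero_add, isValid_one]
      split_ifs with h0
      · exact ⟨false, rfl, h0⟩
      · refine ⟨true, rfl, ?_⟩
        -- Among the `n - t` senders at most `t` signed `false`, and `n - 2 * t ≥ t + 1`.
        have h1 := (Finset.card_le_card (senders_subset_union p.auxValues 0)).trans
          (Finset.card_union_le _ _)
        omega
  | enter hph v P hest hP hv =>
    rw [hp] at *
    rw [hph] at hpos0
    simp only [Phase.idx] at hpos0
    have hpos : ({ p with round := p.round + 1, phase := Phase.waitAux } : Local n).pos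
        = 4 * p.round + 5 := by
      simp [Local.pos, Phase.idx]; ring
    refine
      { round_zero := by simp
        round_pos := by simp
        coinMap_eq := fun r => ?_
        coinRecv_sub := h.coinRecv_sub
        revealed := fun r h1 h2 => h.revealed r h1 (by rw [hpos] at h2; omega)
        sent_pos := fun m hm hmi => ?_
        pos_sent := fun r hr' => ?_
        coin_pos := fun r hr' => by have := h.coin_pos r hr'; rw [hpos]; omega
        pos_coin := fun r h1 h2 => h.pos_coin r h1 (by rw [hpos] at h2; omega)
        authentic := fun a ha => (h.authentic a ha).mono (Finset.subset_insert _ _)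
        recv := h.recv
        aux_valid := fun a ha => (h.aux_valid a ha).imp_right fun h' =>
          ⟨h'.1, by rw [hpos]; omega, h'.2.2⟩
        est_next := by simp
        est_coin := by simp }
    · refine (h.coinMap_eq r).trans (if_congr ?_ rfl rfl)
      rw [hpos]; omega
    · rcases Finset.mem_insert.1 hm with rfl | hm
      · rw [hpos]; simp only; omega
      · have := h.sent_pos m hm hmi
        rw [hpos]; omega
    · rw [hpos] at hr'
      by_cases hr2 : r = p.round + 1
      · exact ⟨_, Finset.mem_insert_self _ _, rfl, hr2.symm⟩
      · obtain ⟨m, hm, h'⟩ := h.pos_sent r (by omega)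
        exact ⟨m, Finset.mem_insert_of_mem hm, h'⟩
  | estimate hph hq =>
    rw [hp] at *
    have hr := h.round_pos (Or.inl hph)
    rw [hph] at hpos0
    simp only [Phase.idx] at hpos0
    have hpos : ∀ e, ({ p with est := e, phase := Phase.waitCoin } : Local n).pos
        = 4 * p.round + 2 := by
      simp [Local.pos, Phase.idx]
    -- The coin of the current round is still unknown, so the messages of this round do not stem
    -- from stored proofs.
    have hval : ∀ (j : Fin n) (b : Bool), (⟨j, p.round, b⟩ : Aux n) ∈ p.auxValues →
        IsValid I.t (fullMap coin) p.round b p.auxValues := fun j b hj =>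
      h.isValid_of_mem_waiting hj (by simp only; omega)
    refine
      { round_zero := by simp
        round_pos := fun _ => hr
        coinMap_eq := fun r => ?_
        coinRecv_sub := h.coinRecv_sub.trans (Finset.subset_insert _ _)
        revealed := fun r h1 h2 => (h.revealed r h1 ?_).mono (Finset.subset_insert _ _)
        sent_pos := fun m hm hmi => ?_
        pos_sent := fun r hr' => h.pos_sent r ?_
        coin_pos := fun r hr' => ?_
        pos_coin := fun r h1 h2 => ?_
        authentic := h.authentic
        recv := h.recv
        aux_valid := fun a ha => (h.aux_valid a ha).imp_right fun h' => ⟨h'.1, ?_, h'.2.2⟩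
        est_next := by simp
        est_coin := fun _ => ⟨fun b hb => ?_, fun hb b => ?_⟩ }
    · refine (h.coinMap_eq r).trans (if_congr ?_ rfl rfl)
      rw [hpos]; omega
    · rw [hpos] at h2; omega
    · rw [hpos]; have := h.sent_pos m hm hmi; omega
    · rw [hpos] at hr'; omega
    · rw [hpos]
      rcases Finset.mem_insert.1 hr' with heq | hr'
      · obtain ⟨-, rfl⟩ := Prod.mk.inj heq
        omega
      · have := h.coin_pos r hr'; omega
    · rw [hpos] at h2
      by_cases hr2 : r = p.round
      · rw [hr2]; exact Finset.mem_insert_self _ _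
      · exact Finset.mem_insert_of_mem (h.pos_coin r h1 (by omega))
    · rw [hpos]; omega
    · have hcard : n - I.t ≤ (signers p.auxValues p.round b).card := by
        simp only at hb
        split_ifs at hb with h1 h2
        · cases hb; exact h1
        · cases hb; exact h2
      refine ⟨hcard, ?_⟩
      obtain ⟨j, hj⟩ := exists_mem_signers_of_quorum (by omega) hcard
      exact hval j b hj
    · have hcard : ¬ n - I.t ≤ (signers p.auxValues p.round (!b)).card := by
        simp only at hb
        split_ifs at hb with h1 h2
        cases b
        · exact h1
        · exact h2
      obtain ⟨j, hj⟩ := exists_mem_of_senders b hq hcard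
      exact hval j b hj
  | learn hph hq =>
    rw [hp] at *
    have hr := h.round_pos (Or.inr (Or.inl hph))
    rw [hph] at hpos0
    simp only [Phase.idx] at hpos0
    have hpos : ∀ e, ({ p with coinMap := e, phase := Phase.coinKnown } : Local n).pos
        = 4 * p.round + 3 := by
      simp [Local.pos, Phase.idx]
    have h := hfr rfl rfl
    refine { h with
      round_zero := by simp
      round_pos := fun _ => hr
      coinMap_eq := fun r => ?_
      revealed := fun r h1 h2 => ?_
      sent_pos := fun m hm hmi => ?_
      pos_sent := fun r hr' => ?_
      coin_pos := fun r hr' => ?_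
      pos_coin := fun r h1 h2 => ?_
      aux_valid := fun a ha => (h.aux_valid a ha).imp_right fun h' => ⟨h'.1, ?_, h'.2.2⟩
      est_next := by simp
      est_coin := fun _ => h.est_coin (Or.inl hph) }
    · rw [hpos]
      by_cases hr2 : r = p.round
      · subst hr2
        simp [hr]
      · simp only [Function.update_of_ne hr2]
        exact (h.coinMap_eq r).trans (if_congr (by omega) rfl rfl)
    · rw [hpos] at h2
      by_cases hr2 : r = p.round
      · subst hr2
        exact hq.trans (Finset.card_le_card (Finset.image_subset_image
          (Finset.filter_subset_filter _ h.coinRecv_sub)))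
      · exact h.revealed r h1 (by omega)
    · rw [hpos]; have := h.sent_pos m hm hmi; omega
    · rw [hpos] at hr'; exact h.pos_sent r (by omega)
    · rw [hpos]; have := h.coin_pos r hr'; omega
    · rw [hpos] at h2; exact h.pos_coin r h1 (by omega)
    · rw [hpos]; omega
  | finish hph b hb =>
    rw [hp] at *
    have hr := h.round_pos (Or.inr (Or.inr hph))
    rw [hph] at hpos0
    simp only [Phase.idx] at hpos0
    have hpos : ∀ d e, ({ p with decision := d, est := e, phase := Phase.nextRound } : Local n).pos
        = 4 * p.round + 4 := by
      simp [Local.pos, Phase.idx]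
    have h := hfr rfl rfl
    obtain ⟨-, -, rfl⟩ := h.coin_eq hb
    refine { h with
      round_zero := by simp
      round_pos := by simp
      coinMap_eq := fun r => ?_
      revealed := fun r h1 h2 => ?_
      sent_pos := fun m hm hmi => ?_
      pos_sent := fun r hr' => ?_
      coin_pos := fun r hr' => ?_
      pos_coin := fun r h1 h2 => ?_
      aux_valid := fun a ha => (h.aux_valid a ha).imp_right fun h' => ⟨h'.1, ?_, h'.2.2⟩
      est_next := fun _ => ?_
      est_coin := by simp }
    · rw [hpos]
      exact (h.coinMap_eq r).trans (if_congr (by omega) rfl rfl)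
    · rw [hpos] at h2; exact h.revealed r h1 (by omega)
    · rw [hpos]; have := h.sent_pos m hm hmi; omega
    · rw [hpos] at hr'; exact h.pos_sent r (by omega)
    · rw [hpos]; have := h.coin_pos r hr'; omega
    · rw [hpos] at h2; exact h.pos_coin r h1 (by omega)
    · rw [hpos]; omega
    · have hfull : fullMap coin p.round = some (coin p.round) := if_neg (by omega)
      obtain ⟨h1, h2⟩ := h.est_coin (Or.inr hph)
      rcases hest : p.est with _ | v
      · refine ⟨coin p.round, by simp, (h2 hest _).succ_of_coin_eq hr hfull⟩
      · refine ⟨v, by simp, ?_⟩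
        obtain ⟨hc, hv⟩ := h1 v hest
        -- If the coin confirms the estimate, its old proof remains one; otherwise the quorum of this
        -- round proves it.
        by_cases hcv : coin p.round = v
        · exact hv.succ_of_coin_eq hr (by rw [hfull, hcv])
        · refine isValid_succ_of_coin_ne hr ?_ hc
          rw [hfull]
          congr 1
          revert hcv
          cases v <;> simp

lemma Inv.initial (I : Instance n) (coin : ℕ → Bool) : Inv I coin (Config.initial n) where
  loc i _ :=
    { round_zero := fun _ => rfl
      round_pos := by simp [Config.initial]
      coinMap_eq := fun r => by
        rw [if_neg]
        · rfl
        · simp [Local.pos, Config.initial, Phase.idx]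
      coinRecv_sub := Finset.empty_subset _
      revealed := fun r h1 h2 => by simp [Local.pos, Config.initial, Phase.idx] at h2
      sent_pos := by simp [Config.initial]
      pos_sent := fun r h => by simp [Local.pos, Config.initial, Phase.idx] at h
      coin_pos := by simp [Config.initial]
      pos_coin := fun r h1 h2 => by simp [Local.pos, Config.initial, Phase.idx] at h2
      authentic := by simp [Config.initial]
      recv := by simp [Config.initial]
      aux_valid := by simp [Config.initial]
      est_next := by simp [Config.initial]
      est_coin := by simp [Config.initial] }
  sent_valid := by simp [Config.initial]
  sent_good := by simp [Config.initial]
  sent_unique := by simp [Config.initial]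

/-- A process signs a new AUX message only for a round in which it has signed none before, and only
with a set that proves its value. -/
lemma LocalStep.new_aux {p' : Local n} {S : Finset (AuxProof n)} {C : Finset (Fin n × ℕ)}
    (hs : LocalStep I coin σ i p' S C) (h : LocalInv I coin σ i (σ.proc i)) :
    S = σ.auxSent ∨ ∃ m, S = insert m σ.auxSent ∧ m.aux.signer = i ∧
      IsValid I.t (fullMap coin) m.aux.round m.aux.val m.proofs ∧
      ∀ m' ∈ σ.auxSent, m'.aux.signer = i → m'.aux.round ≠ m.aux.round := by
  cases hs with
  | start hph =>
    refine Or.inr ⟨_, rfl, rfl, isValid_zero, fun m' hm' hi hr => ?_⟩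
    have h1 := h.sent_pos m' hm' hi
    have h2 := h.round_zero (Or.inl hph)
    simp [Local.pos, h2, hph, Phase.idx] at h1
  | enter hph v P hest hP hv =>
    refine Or.inr ⟨_, rfl, rfl, (h.isValid_iff (h.knowsCoinsBelow ?_) _ _).1 hv,
      fun m' hm' hi hr => ?_⟩
    · simp [Local.pos, hph, Phase.idx]
      omega
    · have h1 := h.sent_pos m' hm' hi
      rw [hr] at h1
      simp [Local.pos, hph, Phase.idx] at h1
      omega
  | _ => exact Or.inl rfl

lemma Trans.inv (hs : Trans I coin σ σ') (h : Inv I coin σ) (ht : 3 * I.t < n) :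
    Inv I coin σ' := by
  cases hs with
  | idle => exact h
  | signCoin j r hj =>
    refine { h with loc := fun i hi => ?_ }
    refine (h.loc i hi).frame (Finset.Subset.refl _) (Finset.subset_insert _ _)
      (fun _ hm _ => hm) fun x hx hxi => ?_
    rcases Finset.mem_insert.1 hx with rfl | hx
    · exact absurd hj (by rw [show j = i from hxi]; exact hi)
    · exact hx
  | step i hi p' S C hl =>
    have hloc : ∀ j ∉ I.faulty, LocalInv I coin ⟨Function.update σ.proc i p', S, C⟩ j
        (Function.update σ.proc i p' j) := fun j hj => by
      by_cases hij : j = i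
      · subst hij
        simpa using hl.localInv (h.loc j hj) ht _
      · rw [Function.update_of_ne hij]
        exact (h.loc j hj).frame hl.auxSent_subset hl.coinSent_subset
          (fun m hm hmj => hl.signer_of_new hm (by rw [hmj]; exact hij))
          (fun x hx hxj => hl.coin_signer_of_new hx (by rw [hxj]; exact hij))
    rcases hl.new_aux (h.loc i hi) with rfl | ⟨m, rfl, rfl, hv, hnew⟩
    · exact { h with loc := hloc }
    · refine ⟨hloc, fun m' hm' => ?_, fun m' hm' => ?_, fun m₁ h₁ m₂ h₂ hs hr => ?_⟩
      · rcases Finset.mem_insert.1 hm' with rfl | hm'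
        · exact hv
        · exact h.sent_valid m' hm'
      · rcases Finset.mem_insert.1 hm' with rfl | hm'
        · exact hi
        · exact h.sent_good m' hm'
      · rcases Finset.mem_insert.1 h₁ with rfl | g₁ <;>
          rcases Finset.mem_insert.1 h₂ with rfl | g₂
        · rfl
        · exact absurd hr.symm (hnew _ g₂ hs.symm)
        · exact absurd hr (hnew _ g₁ hs)
        · exact h.sent_unique _ g₁ _ g₂ hs hr

lemma inv_run (ht : 3 * I.t < n) (adv : Adversary n) (coin : ℕ → Bool) (k : ℕ) :
    Inv I coin (run I adv coin k) := by
  induction k with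
  | zero => exact Inv.initial I coin
  | succ k ih => exact (run_succ_trans I adv coin k).inv ih ht

end Preservation

/-! ### Progress of admissible executions -/

section Progress

variable {I : Instance n} {adv : Adversary n} {coin : ℕ → Bool}

lemma run_auxSent_mono {k k' : ℕ} (h : k ≤ k') :
    (run I adv coin k).auxSent ⊆ (run I adv coin k').auxSent :=
  monotone_nat_of_le_succ (f := fun k => (run I adv coin k).auxSent)
    (fun k => (run_succ_trans I adv coin k).auxSent_subset) h

lemma run_auxValues_mono (i : Fin n) {k k' : ℕ} (h : k ≤ k') :
    ((run I adv coin k).proc i).auxValues ⊆ ((run I adv coin k').proc i).auxValues :=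
  monotone_nat_of_le_succ (f := fun k => ((run I adv coin k).proc i).auxValues)
    (fun k => (run_succ_trans I adv coin k).auxValues_subset i) h

lemma run_coinRecv_mono (i : Fin n) {k k' : ℕ} (h : k ≤ k') :
    ((run I adv coin k).proc i).coinRecv ⊆ ((run I adv coin k').proc i).coinRecv :=
  monotone_nat_of_le_succ (f := fun k => ((run I adv coin k).proc i).coinRecv)
    (fun k => (run_succ_trans I adv coin k).coinRecv_subset i) h

lemma run_pos_mono (i : Fin n) {k k' : ℕ} (h : k ≤ k') :
    ((run I adv coin k).proc i).pos ≤ ((run I adv coin k').proc i).pos :=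
  monotone_nat_of_le_succ (f := fun k => ((run I adv coin k).proc i).pos)
    (fun k => (run_succ_trans I adv coin k).pos_le i) h

lemma run_phase_cases (i : Fin n) {k k' : ℕ} (h : k ≤ k') :
    (((run I adv coin k').proc i).phase = ((run I adv coin k).proc i).phase ∧
      ((run I adv coin k').proc i).round = ((run I adv coin k).proc i).round) ∨
    ((run I adv coin k).proc i).pos < ((run I adv coin k').proc i).pos := by
  induction k', h using Nat.le_induction with
  | base => exact Or.inl ⟨rfl, rfl⟩
  | succ k' hk ih =>
    rcases ih with ih | ih
    · rcases (run_succ_trans I adv coin k').pos_cases i with h | h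
      · exact Or.inl ⟨h.1.trans ih.1, h.2.trans ih.2⟩
      · exact Or.inr ((run_pos_mono i hk).trans_lt h.1)
    · exact Or.inr (ih.trans_le (run_pos_mono i k'.le_succ))

lemma quorum_of_nonfaulty (hF : I.faulty.card ≤ I.t) {X : Finset (Fin n)}
    (h : ∀ j ∉ I.faulty, j ∈ X) : n - I.t ≤ X.card := by
  have h1 : I.faultyᶜ ⊆ X := fun j hj => h j (Finset.mem_compl.1 hj)
  have h2 := Finset.card_le_card h1
  rw [Finset.card_compl, Fintype.card_fin] at h2
  omega

lemma eventually_all_of_mono {Q : Fin n → ℕ → Prop} {F : Finset (Fin n)}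
    (hmono : ∀ j k k', k ≤ k' → Q j k → Q j k') (h : ∀ j ∉ F, ∃ k, Q j k) (K : ℕ) :
    ∃ k ≥ K, ∀ j ∉ F, Q j k := by
  classical
  have h' : ∀ j, ∃ k, j ∉ F → Q j k := fun j => by
    by_cases hj : j ∈ F
    · exact ⟨0, fun h => absurd hj h⟩
    · exact (h j hj).imp fun k hk _ => hk
  choose f hf using h'
  exact ⟨max K (Finset.univ.sup f), le_max_left _ _, fun j hj => hmono j _ _
    ((Finset.le_sup (Finset.mem_univ j)).trans (le_max_right _ _)) (hf j hj)⟩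

lemma Admissible.pos_lt_of_enabled (hadm : Admissible I adv coin) {i : Fin n} (hi : i ∉ I.faulty)
    {k : ℕ} (h : ∃ P, (proceed? I coin (run I adv coin k) i P).isSome) :
    ∃ k', ((run I adv coin k).proc i).pos < ((run I adv coin k').proc i).pos := by
  obtain ⟨k', hk, hne⟩ := hadm.progress k i hi h
  exact ⟨k', (run_phase_cases i hk.le).resolve_left fun h' => hne h'.1⟩

lemma Admissible.quorum_senders (hadm : Admissible I adv coin) (ht : 3 * I.t < n)
    (hF : I.faulty.card ≤ I.t) {r : ℕ}
    (h : ∀ j ∉ I.faulty, ∃ k, 4 * r + 1 ≤ ((run I adv coin k).proc j).pos) {i : Fin n}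
    (hi : i ∉ I.faulty) (K : ℕ) :
    ∃ k ≥ K, n - I.t ≤ (senders ((run I adv coin k).proc i).auxValues r).card := by
  have hrec : ∀ j ∉ I.faulty, ∃ k, j ∈ senders ((run I adv coin k).proc i).auxValues r := by
    intro j hj
    obtain ⟨k₁, hk₁⟩ := h j hj
    obtain ⟨k₂, hk₂⟩ := h i hi
    have hinv := inv_run ht adv coin (max k₁ k₂)
    obtain ⟨m, hm, rfl, rfl⟩ := (hinv.loc j hj).pos_sent r
      (hk₁.trans (run_pos_mono j (le_max_left _ _)))
    have hpos := hk₂.trans (run_pos_mono i (le_max_right k₁ k₂))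
    obtain ⟨k', hk'⟩ := hadm.aux_received _ m hm i hi
      ((hinv.loc i hi).knowsCoinsBelow (by omega))
    exact ⟨k', mem_senders.2 ⟨m.aux.val, ((inv_run ht adv coin k').loc i hi).recv m hk'
      (hinv.sent_valid m hm)⟩⟩
  obtain ⟨k, hk, hall⟩ := eventually_all_of_mono
    (Q := fun j k => j ∈ senders ((run I adv coin k).proc i).auxValues r)
    (fun j k k' hk hj => senders_mono (run_auxValues_mono i hk) r hj) hrec K
  exact ⟨k, hk, quorum_of_nonfaulty hF hall⟩

lemma Admissible.quorum_coin (hadm : Admissible I adv coin) (ht : 3 * I.t < n)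
    (hF : I.faulty.card ≤ I.t) {r : ℕ} (hr : 1 ≤ r)
    (h : ∀ j ∉ I.faulty, ∃ k, 4 * r + 2 ≤ ((run I adv coin k).proc j).pos) {i : Fin n}
    (hi : i ∉ I.faulty) (K : ℕ) :
    ∃ k ≥ K, n - I.t ≤ ((((run I adv coin k).proc i).coinRecv.filter
      (fun x => x.2 = r)).image Prod.fst).card := by
  have hrec : ∀ j ∉ I.faulty, ∃ k, (j, r) ∈ ((run I adv coin k).proc i).coinRecv := by
    intro j hj
    obtain ⟨k, hk⟩ := h j hj
    exact hadm.coin_received k _ (((inv_run ht adv coin k).loc j hj).pos_coin r hr hk) hj i hi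
  obtain ⟨k, hk, hall⟩ := eventually_all_of_mono
    (Q := fun j k => (j, r) ∈ ((run I adv coin k).proc i).coinRecv)
    (fun j k k' hk hj => run_coinRecv_mono i hk hj) hrec K
  refine ⟨k, hk, quorum_of_nonfaulty hF fun j hj => ?_⟩
  exact Finset.mem_image.2 ⟨(j, r), Finset.mem_filter.2 ⟨hall j hj, rfl⟩, rfl⟩

/-- In an admissible execution every non-faulty process passes through all rounds: as long as all of
them reach a place of the program, the process waiting there receives what it waits for. -/
theorem Admissible.reaches (hadm : Admissible I adv coin) (ht : 3 * I.t < n)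
    (hF : I.faulty.card ≤ I.t) (N : ℕ) :
    ∀ i ∉ I.faulty, ∃ k, N ≤ ((run I adv coin k).proc i).pos := by
  induction N with
  | zero => exact fun i _ => ⟨0, Nat.zero_le _⟩
  | succ N ih =>
    intro i hi
    obtain ⟨k, hk⟩ := ih i hi
    rcases hk.lt_or_eq with hlt | heq
    · exact ⟨k, hlt⟩
    have hloc := (inv_run ht adv coin k).loc i hi
    -- It suffices that the process is able to move once at a later time, if it still waits then.
    suffices hen : ∃ k₁ ≥ k, ((run I adv coin k₁).proc i).phase = ((run I adv coin k).proc i).phase →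
        ((run I adv coin k₁).proc i).round = ((run I adv coin k).proc i).round →
        ∃ P, (proceed? I coin (run I adv coin k₁) i P).isSome by
      obtain ⟨k₁, hk₁, hen⟩ := hen
      rcases run_phase_cases (I := I) (adv := adv) (coin := coin) i hk₁ with hs | hs
      · obtain ⟨k₂, hk₂⟩ := hadm.pos_lt_of_enabled hi (hen hs.1 hs.2)
        have := run_pos_mono (I := I) (adv := adv) (coin := coin) i hk₁
        exact ⟨k₂, by omega⟩
      · exact ⟨k₁, by omega⟩
    have hpos : N = 4 * ((run I adv coin k).proc i).round +
      ((run I adv coin k).proc i).phase.idx := heq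
    rcases hph : ((run I adv coin k).proc i).phase
    · exact ⟨k, le_rfl, fun _ _ => ⟨∅, by simp [proceed?, hph]⟩⟩
    · have hr := hloc.round_zero (Or.inr hph)
      obtain ⟨k₁, hk₁, hq⟩ := hadm.quorum_senders ht hF (r := 0)
        (by simpa [hpos, hph, hr, Phase.idx] using ih) hi k
      exact ⟨k₁, hk₁, fun h1 _ => ⟨∅, by simp only [proceed?, h1, if_pos hq]; rfl⟩⟩
    · obtain ⟨v, hv, hval⟩ := hloc.est_next hph
      have hkn : KnowsCoinsBelow ((run I adv coin k).proc i)
          (((run I adv coin k).proc i).round + 1) := by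
        refine hloc.knowsCoinsBelow ?_
        rw [← heq, hpos, hph]
        simp only [Phase.idx]
        omega
      refine ⟨k, le_rfl, fun _ _ => ⟨((run I adv coin k).proc i).auxValues, ?_⟩⟩
      have hc := And.intro (Finset.Subset.refl ((run I adv coin k).proc i).auxValues)
        ((hloc.isValid_iff hkn _ _).2 hval)
      simp only [proceed?, hph, hv, if_pos hc]
      rfl
    · obtain ⟨k₁, hk₁, hq⟩ := hadm.quorum_senders ht hF (r := ((run I adv coin k).proc i).round)
        (by simpa [hpos, hph, Phase.idx] using ih) hi k
      refine ⟨k₁, hk₁, fun h1 h2 => ⟨∅, ?_⟩⟩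
      rw [← h2] at hq
      simp only [proceed?, h1, if_pos hq]
      rfl
    · obtain ⟨k₁, hk₁, hq⟩ := hadm.quorum_coin ht hF (r := ((run I adv coin k).proc i).round)
        (hloc.round_pos (Or.inr (Or.inl hph))) (by simpa [hpos, hph, Phase.idx] using ih) hi k
      refine ⟨k₁, hk₁, fun h1 h2 => ⟨∅, ?_⟩⟩
      rw [← h2] at hq
      simp only [proceed?, h1, if_pos hq]
      rfl
    · have hr := hloc.round_pos (Or.inr (Or.inr hph))
      have hc : ((run I adv coin k).proc i).coinMap ((run I adv coin k).proc i).round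
          = some (coin ((run I adv coin k).proc i).round) := by
        have h3 : 4 * ((run I adv coin k).proc i).round + 3 ≤ ((run I adv coin k).proc i).pos := by
          rw [← heq, hpos, hph, Phase.idx]
        rw [hloc.coinMap_eq, if_pos ⟨hr, h3⟩]
      refine ⟨k, le_rfl, fun _ _ => ⟨∅, ?_⟩⟩
      simp [proceed?, hph, hc]

lemma Admissible.exists_revealed (hadm : Admissible I adv coin) (ht : 3 * I.t < n)
    (hF : I.faulty.card ≤ I.t) {r : ℕ} (hr : 1 ≤ r) :
    ∃ k, IsLeast {k | Revealed I (run I adv coin k) r} k := by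
  classical
  have hex : ∃ k, Revealed I (run I adv coin k) r := by
    obtain ⟨k, -, hall⟩ := eventually_all_of_mono
      (Q := fun j k => 4 * r + 2 ≤ ((run I adv coin k).proc j).pos) (F := I.faulty)
      (fun j k k' hk hj => hj.trans (run_pos_mono j hk)) (hadm.reaches ht hF _) 0
    refine ⟨k, quorum_of_nonfaulty hF fun j hj => ?_⟩
    exact Finset.mem_image.2 ⟨(j, r), Finset.mem_filter.2
      ⟨((inv_run ht adv coin k).loc j hj).pos_coin r hr (hall j hj), rfl⟩, rfl⟩
  exact ⟨Nat.find hex, Nat.find_spec hex, fun k hk => Nat.find_min' hex hk⟩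

end Progress

/-! ### The execution before a coin is revealed does not depend on that coin -/

section Prefix

variable {I : Instance n} {adv : Adversary n} {coin coin' : ℕ → Bool} {σ : Config n}

/-- Coins are revealed in the order of the rounds. -/
lemma Inv.revealed_of_le (h : Inv I coin σ) (ht : 3 * I.t < n) (hF : I.faulty.card ≤ I.t)
    {r r' : ℕ} (hr : 1 ≤ r) (hrr : r ≤ r') (hrev : Revealed I σ r') : Revealed I σ r := by
  rcases hrr.eq_or_lt with rfl | hlt
  · exact hrev
  have hcard : I.faulty.card < (participants σ r').card := by
    have : n - I.t ≤ (participants σ r').card := hrev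
    omega
  obtain ⟨j, hj, hjF⟩ := Finset.exists_mem_notMem_of_card_lt_card hcard
  simp only [participants, Finset.mem_image, Finset.mem_filter] at hj
  obtain ⟨⟨j', q⟩, ⟨hmem, rfl⟩, rfl⟩ := hj
  have := (h.loc _ hjF).coin_pos _ hmem
  simp only at hlt
  exact (h.loc _ hjF).revealed r hr (by omega)

lemma Inv.step_congr (h : Inv I coin σ) (hc : ∀ r, Revealed I σ r → coin r = coin' r)
    (a : Action n) : step I coin σ a = step I coin' σ a := by
  cases a with
  | proceed i P =>
    simp only [step]
    split_ifs with hi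
    · rfl
    congr 1
    unfold proceed?
    simp only
    split
    · rfl
    · rfl
    · rfl
    · rfl
    · split_ifs with hq
      · rw [hc]
        exact hq.trans (Finset.card_le_card (Finset.image_subset_image
          (Finset.filter_subset_filter _ (h.loc i hi).coinRecv_sub)))
      · rfl
    · rfl
  | _ => rfl

/-- Coin sequences that agree on the rounds before `s` lead to the same execution up to the moment
at which the coin of round `s` is revealed. -/
lemma runAux_congr (ht : 3 * I.t < n) (hF : I.faulty.card ≤ I.t) {s : ℕ} (hs : 1 ≤ s)
    (hc : ∀ r < s, coin r = coin' r) (k : ℕ)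
    (hk : ∀ j < k, ¬ Revealed I (run I adv coin j) s) :
    runAux I adv coin k = runAux I adv coin' k := by
  induction k with
  | zero => rfl
  | succ k ih =>
    have ih := ih fun j hj => hk j (hj.trans k.lt_succ_self)
    have hinv := inv_run ht adv coin k
    have hrev : ∀ r, Revealed I (run I adv coin k) r → coin r = coin' r := fun r hr => hc r <| by
      by_contra! hsr
      exact hk k k.lt_succ_self (hinv.revealed_of_le ht hF hs hsr hr)
    have hview : view I coin (run I adv coin k) = view I coin' (run I adv coin k) := by
      unfold view
      congr 1
      funext r
      split_ifs with h
      · rw [hrev r h]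
      · rfl
    have hrun : run I adv coin k = (runAux I adv coin' k).1 := congrArg Prod.fst ih
    simp only [runAux]
    rw [← hrun, ← ih]
    change (step I coin (run I adv coin k) (adv (view I coin (run I adv coin k) :: _)), _) = _
    rw [hinv.step_congr hrev, ← hview]
    rfl

lemma run_congr_of_isLeast (ht : 3 * I.t < n) (hF : I.faulty.card ≤ I.t) {s : ℕ} (hs : 1 ≤ s)
    (hc : ∀ r < s, coin r = coin' r) {k : ℕ}
    (hk : IsLeast {k | Revealed I (run I adv coin k) s} k) {j : ℕ} (hj : j ≤ k) :
    run I adv coin j = run I adv coin' j :=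
  congrArg Prod.fst (runAux_congr ht hF hs hc j fun j' hj' hrev =>
    absurd (hk.2 hrev) (by omega))

lemma isLeast_revealed_congr (ht : 3 * I.t < n) (hF : I.faulty.card ≤ I.t) {s : ℕ} (hs : 1 ≤ s)
    (hc : ∀ r < s, coin r = coin' r) {k : ℕ}
    (hk : IsLeast {k | Revealed I (run I adv coin k) s} k) :
    IsLeast {k | Revealed I (run I adv coin' k) s} k := by
  have heq := fun j hj => run_congr_of_isLeast (adv := adv) ht hF hs hc hk (j := j) hj
  refine ⟨?_, fun j hj => ?_⟩
  · have := hk.1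
    simp only [Set.mem_ofPred_eq] at this ⊢
    rwa [← heq k le_rfl]
  · by_contra! hlt
    simp only [Set.mem_ofPred_eq] at hj
    rw [← heq j hlt.le] at hj
    exact absurd (hk.2 hj) (by omega)

/-- Whether decision is guaranteed at round `s` depends only on the coins of the rounds up to
`s`. -/
lemma GuaranteedAt.congr (ht : 3 * I.t < n) (hF : I.faulty.card ≤ I.t) {s : ℕ}
    (hc : ∀ r ≤ s, coin r = coin' r) (h : GuaranteedAt I adv coin s) :
    GuaranteedAt I adv coin' s := by
  obtain ⟨hs, k, hk, hg⟩ := h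
  have hc' : ∀ r < s, coin r = coin' r := fun r hr => hc r hr.le
  refine ⟨hs, k, isLeast_revealed_congr ht hF hs hc' hk, fun adv₁ coin₁ hrun hcoin hadm => ?_⟩
  rw [← hc s le_rfl]
  refine hg adv₁ coin₁ (fun j hj => ?_) (fun r hr => ?_) hadm
  · rw [hrun j hj, run_congr_of_isLeast ht hF hs hc' hk hj]
  · rw [hcoin r hr, hc r hr]

end Prefix

/-! ### A blocked value leads to a decision -/

section Lock

variable {I : Instance n} {adv : Adversary n} {coin : ℕ → Bool} {σ : Config n} {i : Fin n}

/-- In round `r` the value `!coin r` cannot be proved valid: then a process that waits for the coin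
of round `r` holds a quorum for `coin r`, and it decides before it leaves the round. -/
def DecisionInv (I : Instance n) (coin : ℕ → Bool) (r : ℕ) (p : Local n) : Prop :=
  (p.phase = .waitCoin ∨ p.phase = .coinKnown → p.round = r →
    n - I.t ≤ (signers p.auxValues r (coin r)).card) ∧
  (p.phase = .nextRound → p.round = r → p.decision ≠ none)

lemma LocalStep.decisionInv {p' : Local n} {S : Finset (AuxProof n)} {C : Finset (Fin n × ℕ)}
    (hs : LocalStep I coin σ i p' S C) (h : LocalInv I coin σ i (σ.proc i)) {r : ℕ} (hr : 1 ≤ r)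
    (hno : ¬ IsValid I.t (fullMap coin) r (!coin r) (σ.proc i).auxValues)
    (hd : DecisionInv I coin r (σ.proc i)) : DecisionInv I coin r p' := by
  cases hs with
  | reject m hk hv => exact hd
  | accept m kept ha hpf hk hsub hv hmin =>
    refine ⟨fun hph hr' => (hd.1 hph hr').trans (Finset.card_le_card (signers_mono ?_ _ _)), hd.2⟩
    exact Finset.subset_union_left.trans (Finset.subset_insert _ _)
  | recvCoin x hx => exact hd
  | start hph => simp [DecisionInv]
  | init hph hq =>
    have := h.round_zero (Or.inr hph)
    refine ⟨by simp, fun _ hr' => ?_⟩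
    simp only at hr'
    omega
  | enter hph v P hest hP hv => simp [DecisionInv]
  | estimate hph hq =>
    refine ⟨fun _ hr' => ?_, by simp⟩
    simp only at hr' ⊢
    rw [hr'] at hq
    refine hq.trans (Finset.card_le_card (senders_subset_signers fun a ha har => ?_))
    by_contra hne
    have hval := h.isValid_of_mem_waiting ha (by simp [Local.pos, hph, Phase.idx, hr', har])
    have hav : a.val = !coin r := by
      revert hne
      cases a.val <;> cases coin r <;> simp
    rw [har, hav] at hval
    exact hno hval
  | learn hph hq => exact ⟨fun _ hr' => hd.1 (Or.inl hph) hr', by simp⟩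
  | finish hph b hb =>
    refine ⟨by simp, fun _ hr' => ?_⟩
    simp only at hr' ⊢
    have hq := hd.1 (Or.inr hph) hr'
    obtain ⟨-, -, rfl⟩ := h.coin_eq hb
    rw [hr']
    by_cases hdec : (σ.proc i).decision = none
    · simp [hdec, hq]
    · simp [hdec]

lemma Admissible.decidesBy_of_invalid (hadm : Admissible I adv coin) (ht : 3 * I.t < n)
    (hF : I.faulty.card ≤ I.t) {r : ℕ} (hr : 1 ≤ r)
    (hno : ∀ k, ∀ i ∉ I.faulty, ¬ IsValid I.t (fullMap coin) r (!coin r)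
      ((run I adv coin k).proc i).auxValues) (hi : i ∉ I.faulty) :
    DecidesBy I adv coin i r := by
  classical
  have hd : ∀ k, DecisionInv I coin r ((run I adv coin k).proc i) := by
    intro k
    induction k with
    | zero => simp [DecisionInv, run_zero, Config.initial]
    | succ k ih =>
      rcases (run_succ_trans I adv coin k).proc_cases i with h | h
      · rw [h.1]
        exact ih
      · exact h.decisionInv ((inv_run ht adv coin k).loc i hi) hr (hno k i hi) ih
  -- The first moment at which the process has finished round `r`.
  have hex := hadm.reaches ht hF (4 * r + 4) i hi
  obtain ⟨hk, hmin⟩ := And.intro (Nat.find_spec hex) fun j hj => Nat.find_min hex (m := j) hj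
  generalize Nat.find hex = k at hk hmin
  have hinv := (inv_run ht adv coin k).loc i hi
  have hle : ((run I adv coin k).proc i).pos ≤ 4 * r + 4 := by
    cases k with
    | zero => simp [run_zero, Config.initial, Local.pos, Phase.idx]
    | succ k =>
      have hlt := hmin k k.lt_succ_self
      have hk0 := (inv_run ht adv coin k).loc i hi
      rcases (run_succ_trans I adv coin k).pos_cases i with h | ⟨-, h | ⟨h1, h2, h3⟩⟩
      · rw [Local.pos, h.1, h.2]
        exact (not_le.1 hlt).le
      · omega
      · rw [Local.pos, h2, h3, hk0.round_zero (Or.inr h1)]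
        simp [Phase.idx]
  have hpos : ((run I adv coin k).proc i).pos = 4 * ((run I adv coin k).proc i).round +
    ((run I adv coin k).proc i).phase.idx := rfl
  have hz := hinv.round_zero
  refine ⟨k, ?_⟩
  rcases hph : ((run I adv coin k).proc i).phase <;> rw [hph] at hpos hz <;>
    simp only [Phase.idx] at hpos
  · have := hz (Or.inl rfl)
    omega
  · omega
  · exact ⟨(hd k).2 hph (by omega), by omega⟩
  · omega
  · omega
  · omega

/-- If `t + 1` non-faulty processes never sign `!coin s` in round `s`, then `!coin s` never gets a
quorum in round `s`. So it is invalid in all rounds up to the next one whose coin equals `coin s`,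
and in that round all non-faulty processes decide. -/
theorem Admissible.decidesBy_of_lock (hadm : Admissible I adv coin) (ht : 3 * I.t < n)
    (hF : I.faulty.card ≤ I.t) {s : ℕ} (hs : 1 ≤ s) {Y : Finset (Fin n)}
    (hYF : ∀ j ∈ Y, j ∉ I.faulty) (hY : I.t + 1 ≤ Y.card)
    (hnever : ∀ k, ∀ m ∈ (run I adv coin k).auxSent, m.aux.signer ∈ Y → m.aux.round = s →
      m.aux.val = coin s) {r : ℕ} (hsr : s < r) (hr : coin r = coin s) (hi : i ∉ I.faulty) :
    DecidesBy I adv coin i r := by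
  classical
  have hex : ∃ r, s < r ∧ coin r = coin s := ⟨r, hsr, hr⟩
  obtain ⟨⟨hlt, heq⟩, hmin⟩ := And.intro (Nat.find_spec hex)
    fun j hj => Nat.find_min hex (m := j) hj
  have hle : Nat.find hex ≤ r := Nat.find_min' hex ⟨hsr, hr⟩
  generalize Nat.find hex = r₀ at hlt heq hmin hle
  suffices h : DecidesBy I adv coin i r₀ by
    obtain ⟨k, hk, hkr⟩ := h
    exact ⟨k, hk, hkr.trans hle⟩
  refine hadm.decidesBy_of_invalid ht hF (by omega) (fun k j hj hval => ?_) hi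
  have hprev : prevRound (fullMap coin) r₀ (!coin r₀) = s := by
    refine prevRound_eq_of_gap ?_ hlt fun p hp hpr hc => hmin p hpr ⟨hp, ?_⟩
    · rw [fullMap, if_neg (by omega), heq, Bool.not_not]
    · rw [fullMap, if_neg (by omega), heq, Bool.not_not] at hc
      exact Option.some.inj hc
  rw [IsValid, if_neg (by omega), if_neg (by omega), hprev] at hval
  have hq := hval.resolve_left fun h => by omega
  -- The signers of `!coin s` and the `t + 1` members of `Y` do not fit together into `n` processes.
  have hdisj : Disjoint (signers ((run I adv coin k).proc j).auxValues s (!coin r₀)) Y := by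
    refine Finset.disjoint_left.2 fun y hy hyY => ?_
    rcases ((inv_run ht adv coin k).loc j hj).authentic _ (mem_signers.1 hy) with hyF | hys
    · exact hYF y hyY hyF
    · obtain ⟨m, hm, hma⟩ := Finset.mem_image.1 hys
      have := hnever k m hm (by rw [hma]; exact hyY) (by rw [hma])
      rw [hma, heq] at this
      simp at this
  have hcard := Finset.card_le_univ
    (signers ((run I adv coin k).proc j).auxValues s (!coin r₀) ∪ Y)
  rw [Finset.card_union_of_disjoint hdisj, Fintype.card_fin] at hcard
  omega

end Lock

/-! ### Rounds whose coin guarantees decision -/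

section Guarantee

variable {I : Instance n} {adv : Adversary n} {coin : ℕ → Bool} {σ : Config n} {i : Fin n}

/-- If `t + 1` non-faulty processes have signed the value of the coin when it is revealed, then
decision is guaranteed. -/
lemma guaranteedAt_of_votes (ht : 3 * I.t < n) (hF : I.faulty.card ≤ I.t) {s : ℕ} (hs : 1 ≤ s)
    {k : ℕ} (hk : IsLeast {k | Revealed I (run I adv coin k) s} k)
    (hvotes : I.t + 1 ≤
      (signers ((run I adv coin k).auxSent.image AuxProof.aux) s (coin s)).card) :
    GuaranteedAt I adv coin s := by
  refine ⟨hs, k, hk, fun adv' coin' hrun hcoin hadm r hsr hr i hi => ?_⟩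
  rw [← hcoin s le_rfl] at hr hvotes
  rw [← hrun k le_rfl] at hvotes
  have hmem : ∀ j ∈ signers ((run I adv' coin' k).auxSent.image AuxProof.aux) s (coin' s),
      ∃ m ∈ (run I adv' coin' k).auxSent, m.aux = ⟨j, s, coin' s⟩ := fun j hj =>
    Finset.mem_image.1 (mem_signers.1 hj)
  refine hadm.decidesBy_of_lock ht hF hs (fun j hj => ?_) hvotes (fun k' m hm hmY hms => ?_)
    hsr hr hi
  · obtain ⟨m, hm, hma⟩ := hmem j hj
    have := (inv_run ht adv' coin' k).sent_good m hm
    rwa [hma] at this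
  · obtain ⟨m', hm', hma⟩ := hmem _ hmY
    have := (inv_run ht adv' coin' (max k k')).sent_unique
      m (run_auxSent_mono (le_max_right _ _) hm) m' (run_auxSent_mono (le_max_left _ _) hm')
      (by rw [hma]) (by rw [hma, hms])
    rw [this, hma]

/-- The invariant of a process that reaches the coin of round `r` without an estimate: it adopts this
coin as its estimate, and it signs no other value in the next round. -/
def Adopts (coin : ℕ → Bool) (r : ℕ) (i : Fin n) (p : Local n) (S : Finset (AuxProof n)) : Prop :=
  (p.phase = .waitCoin ∧ p.round = r ∧ p.est = none ∨
    p.phase = .coinKnown ∧ p.round = r ∧ p.est = none ∨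
    p.phase = .nextRound ∧ p.round = r ∧ p.est = some (coin r) ∨ r < p.round) ∧
  ∀ m ∈ S, m.aux.signer = i → m.aux.round = r + 1 → m.aux.val = coin r

lemma LocalStep.adopts {p' : Local n} {S : Finset (AuxProof n)} {C : Finset (Fin n × ℕ)}
    (hs : LocalStep I coin σ i p' S C) (h : LocalInv I coin σ i (σ.proc i)) {r : ℕ}
    (ha : Adopts coin r i (σ.proc i) σ.auxSent) : Adopts coin r i p' S := by
  obtain ⟨hd, hm⟩ := ha
  cases hs with
  | reject m hk hv => exact ⟨hd, hm⟩
  | accept m kept ha hpf hk hsub hv hmin => exact ⟨hd, hm⟩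
  | recvCoin x hx => exact ⟨hd, hm⟩
  | start hph =>
    simp only [hph, reduceCtorEq, false_and, false_or] at hd
    refine ⟨by simp [hd], fun m' hm' hi' hr' => ?_⟩
    rcases Finset.mem_insert.1 hm' with rfl | hm'
    · simp at hr'
    · exact hm m' hm' hi' hr'
  | init hph hq =>
    simp only [hph, reduceCtorEq, false_and, false_or] at hd
    exact ⟨by simp [hd], hm⟩
  | enter hph v P hest hP hv =>
    simp only [hph, reduceCtorEq, false_and, false_or, true_and] at hd
    refine ⟨by simp; omega, fun m' hm' hi' hr' => ?_⟩
    rcases Finset.mem_insert.1 hm' with rfl | hm'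
    · simp only [Nat.add_right_cancel_iff] at hr'
      rw [hest] at hd
      rcases hd with hd | hd
      · exact Option.some.inj hd.2
      · omega
    · exact hm m' hm' hi' hr'
  | estimate hph hq =>
    simp only [hph, reduceCtorEq, false_and, false_or] at hd
    exact ⟨by simp [hd], hm⟩
  | learn hph hq =>
    simp only [hph, reduceCtorEq, false_and, false_or, true_and] at hd
    exact ⟨by simpa using hd, hm⟩
  | finish hph b hb =>
    simp only [hph, reduceCtorEq, false_and, false_or, true_and] at hd
    obtain ⟨-, -, rfl⟩ := h.coin_eq hb
    refine ⟨?_, hm⟩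
    rcases hd with ⟨rfl, hest⟩ | hd
    · simp [hest]
    · simp [hd]

lemma adopts_run (ht : 3 * I.t < n) (hi : i ∉ I.faulty) {k r : ℕ}
    (hph : ((run I adv coin k).proc i).phase = .waitCoin)
    (hr : ((run I adv coin k).proc i).round = r)
    (hest : ((run I adv coin k).proc i).est = none) {k' : ℕ} (hk : k ≤ k') :
    Adopts coin r i ((run I adv coin k').proc i) (run I adv coin k').auxSent := by
  induction k', hk using Nat.le_induction with
  | base =>
    refine ⟨Or.inl ⟨hph, hr, hest⟩, fun m hm hmi hmr => ?_⟩
    have := ((inv_run ht adv coin k).loc i hi).sent_pos m hm hmi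
    simp only [Local.pos, hph, hr, hmr, Phase.idx] at this
    omega
  | succ k' hk ih =>
    rcases (run_succ_trans I adv coin k').proc_cases i with h | h
    · rw [h.1]
      exact ⟨ih.1, fun m hm hmi hmr => ih.2 m (h.2 m hm hmi) hmi hmr⟩
    · exact h.adopts ((inv_run ht adv coin k').loc i hi) ih

/-- If `t + 1` non-faulty processes have no estimate when the coin of round `s` is revealed, then
all of them adopt this coin, and decision is guaranteed at the next round if its coin is the
same. -/
lemma guaranteedAt_succ_of_undecided (ht : 3 * I.t < n) (hF : I.faulty.card ≤ I.t) {s : ℕ}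
    (hs : 1 ≤ s) {k k' : ℕ} (hk : IsLeast {k | Revealed I (run I adv coin k) s} k)
    (hk' : IsLeast {k | Revealed I (run I adv coin k) (s + 1)} k') {Y : Finset (Fin n)}
    (hYF : ∀ j ∈ Y, j ∉ I.faulty) (hY : I.t + 1 ≤ Y.card)
    (hund : ∀ j ∈ Y, ((run I adv coin k).proc j).phase = .waitCoin ∧
      ((run I adv coin k).proc j).round = s ∧ ((run I adv coin k).proc j).est = none)
    (hc : coin (s + 1) = coin s) : GuaranteedAt I adv coin (s + 1) := by
  have hkk : k ≤ k' :=
    hk.2 ((inv_run ht adv coin k').revealed_of_le ht hF hs s.le_succ hk'.1)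
  refine ⟨by omega, k', hk', fun adv' coin' hrun hcoin hadm r hsr hr i hi => ?_⟩
  rw [← hrun k hkk] at hund
  rw [← hcoin (s + 1) le_rfl, ← hcoin s s.le_succ] at hc
  rw [← hcoin (s + 1) le_rfl] at hr
  refine hadm.decidesBy_of_lock ht hF (by omega) hYF hY (fun j m hm hmY hms => ?_) hsr hr hi
  obtain ⟨h1, h2, h3⟩ := hund _ hmY
  rw [hc]
  exact (adopts_run ht (hYF _ hmY) h1 h2 h3 (le_max_left k j)).2 m
    (run_auxSent_mono (le_max_right k j) hm) rfl hms

/-- A process can have learned the coin of round `r` only if the coin was revealed before its last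
step. -/
lemma Trans.revealed_of_pos {σ' : Config n} (hs : Trans I coin σ σ') (hinv : Inv I coin σ)
    (hi : i ∉ I.faulty) {r : ℕ} (hr : 1 ≤ r) (hpos : 4 * r + 3 ≤ (σ'.proc i).pos) :
    Revealed I σ r := by
  have h := hinv.loc i hi
  rcases hs.proc_cases i with hs | hs
  · rw [hs.1] at hpos
    exact h.revealed r hr hpos
  · generalize σ'.proc i = p', σ'.auxSent = S, σ'.coinSent = C at hs hpos
    cases hs with
    | reject m hk hv => exact h.revealed r hr hpos
    | accept m kept ha hpf hk hsub hv hmin => exact h.revealed r hr hpos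
    | recvCoin x hx => exact h.revealed r hr hpos
    | start hph =>
      refine h.revealed r hr ?_
      simp only [Local.pos, hph, Phase.idx] at hpos ⊢
      omega
    | init hph hq =>
      have := h.round_zero (Or.inr hph)
      simp only [Local.pos, Phase.idx] at hpos
      omega
    | enter hph v P hest hP hv =>
      refine h.revealed r hr ?_
      simp only [Local.pos, hph, Phase.idx] at hpos ⊢
      omega
    | estimate hph hq =>
      refine h.revealed r hr ?_
      simp only [Local.pos, hph, Phase.idx] at hpos ⊢
      omega
    | learn hph hq =>
      by_cases hr2 : r = (σ.proc i).round
      · subst hr2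
        exact hq.trans (Finset.card_le_card (Finset.image_subset_image
          (Finset.filter_subset_filter _ h.coinRecv_sub)))
      · refine h.revealed r hr ?_
        simp only [Local.pos, hph, Phase.idx] at hpos ⊢
        omega
    | finish hph b hb =>
      refine h.revealed r hr ?_
      simp only [Local.pos, hph, Phase.idx] at hpos ⊢
      omega

/-- When the coin of round `s` is revealed, either some value has been signed by `t + 1` non-faulty
processes, or `t + 1` non-faulty processes wait for the coin without an estimate. -/
lemma exists_undecided (ht : 3 * I.t < n) (hF : I.faulty.card ≤ I.t) {s : ℕ} (hs : 1 ≤ s)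
    {k : ℕ} (hk : IsLeast {k | Revealed I (run I adv coin k) s} k)
    (hvotes : ∀ b, ¬ I.t + 1 ≤
      (signers ((run I adv coin k).auxSent.image AuxProof.aux) s b).card) :
    ∃ Y : Finset (Fin n), (∀ j ∈ Y, j ∉ I.faulty) ∧ I.t + 1 ≤ Y.card ∧
      ∀ j ∈ Y, ((run I adv coin k).proc j).phase = .waitCoin ∧
        ((run I adv coin k).proc j).round = s ∧ ((run I adv coin k).proc j).est = none := by
  have hrev : n - I.t ≤ (participants (run I adv coin k) s).card := hk.1
  refine ⟨participants (run I adv coin k) s \ I.faulty, fun j hj => (Finset.mem_sdiff.1 hj).2,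
    ?_, fun j hj => ?_⟩
  · have := Finset.le_card_sdiff I.faulty (participants (run I adv coin k) s)
    omega
  · obtain ⟨hj, hjF⟩ := Finset.mem_sdiff.1 hj
    have h := (inv_run ht adv coin k).loc j hjF
    have hlow : 4 * s + 2 ≤ ((run I adv coin k).proc j).pos := by
      simp only [participants, Finset.mem_image, Finset.mem_filter] at hj
      obtain ⟨⟨j', q⟩, ⟨hmem, rfl⟩, rfl⟩ := hj
      exact (h.coin_pos _ hmem).2
    have hup : ((run I adv coin k).proc j).pos < 4 * s + 3 := by
      by_contra! hge
      cases k with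
      | zero =>
        simp [run_zero, Config.initial, Local.pos, Phase.idx] at hge
      | succ k =>
        have := hk.2 ((run_succ_trans I adv coin k).revealed_of_pos (inv_run ht adv coin k) hjF
          hs hge)
        omega
    have hpos : ((run I adv coin k).proc j).pos = 4 * ((run I adv coin k).proc j).round +
      ((run I adv coin k).proc j).phase.idx := rfl
    have hph : ((run I adv coin k).proc j).phase = .waitCoin := by
      have hz := h.round_zero
      rcases hph : ((run I adv coin k).proc j).phase <;> rw [hph] at hpos hz <;>
        simp only [Phase.idx] at hpos
      · have := hz (Or.inl rfl)
        omega
      all_goals first | rfl | omega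
    rw [hph, Phase.idx] at hpos
    have hround : ((run I adv coin k).proc j).round = s := by omega
    refine ⟨hph, hround, ?_⟩
    rcases hest : ((run I adv coin k).proc j).est with _ | b
    · rfl
    · have hq := ((h.est_coin (Or.inl hph)).1 b hest).1
      rw [hround] at hq
      refine absurd ?_ (hvotes b)
      have h1 := Finset.le_card_sdiff I.faulty
        (signers ((run I adv coin k).proc j).auxValues s b)
      have h2 : signers ((run I adv coin k).proc j).auxValues s b \ I.faulty ⊆
          signers ((run I adv coin k).auxSent.image AuxProof.aux) s b := fun y hy => by
        obtain ⟨hy, hyF⟩ := Finset.mem_sdiff.1 hy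
        exact mem_signers.2 ((h.authentic _ (mem_signers.1 hy)).resolve_left hyF)
      have h3 := Finset.card_le_card h2
      omega

end Guarantee

/-! ### Fair coins -/

instance : IsProbabilityMeasure coinLaw := by
  unfold coinLaw
  infer_instance

/-- The event `A` is determined by the coins of the rounds before `N`. -/
def DeterminedBelow (N : ℕ) (A : Set (ℕ → Bool)) : Prop :=
  ∀ c c' : ℕ → Bool, (∀ r < N, c r = c' r) → c ∈ A → c' ∈ A

namespace DeterminedBelow

variable {N M : ℕ} {A B : Set (ℕ → Bool)}

lemma mono (h : DeterminedBelow N A) (hNM : N ≤ M) : DeterminedBelow M A :=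
  fun c c' hc => h c c' fun r hr => hc r (hr.trans_le hNM)

lemma inter (hA : DeterminedBelow N A) (hB : DeterminedBelow N B) : DeterminedBelow N (A ∩ B) :=
  fun c c' hc h => ⟨hA c c' hc h.1, hB c c' hc h.2⟩

lemma compl (hA : DeterminedBelow N A) : DeterminedBelow N Aᶜ :=
  fun c c' hc h h' => h (hA c' c (fun r hr => (hc r hr).symm) h')

lemma measurableSet (hA : DeterminedBelow N A) : MeasurableSet A := by
  let g : (ℕ → Bool) → (Fin N → Bool) := fun c i => c i
  have hg : Measurable g := measurable_pi_lambda _ fun i => measurable_pi_apply _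
  have : A = g ⁻¹' (g '' A) := by
    refine Set.Subset.antisymm (Set.subset_preimage_image g A) ?_
    rintro c ⟨c', hc', hcc⟩
    exact hA c' c (fun r hr => congrFun hcc ⟨r, hr⟩) hc'
  rw [this]
  exact hg (Set.toFinite _).measurableSet

end DeterminedBelow

/-- Reverses the coin of round `N`. -/
def flipCoin (N : ℕ) (c : ℕ → Bool) : ℕ → Bool := fun i => if i = N then !c i else c i

lemma measurePreserving_flipCoin (N : ℕ) : MeasurePreserving (flipCoin N) coinLaw coinLaw := by
  let f : ℕ → Bool → Bool := fun i b => if i = N then !b else b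
  have hf : ∀ i, Measurable (f i) := fun i => measurable_of_countable _
  have hfair : ∀ i, (PMF.uniformOfFintype Bool).toMeasure.map (f i)
      = (PMF.uniformOfFintype Bool).toMeasure := by
    intro i
    rw [PMF.toMeasure_map (f i) _ (hf i)]
    congr 1
    ext b
    by_cases hi : i = N <;> cases b <;> simp [PMF.map_apply, f, hi, tsum_fintype]
  refine ⟨measurable_pi_lambda _ fun i => (hf i).comp (measurable_pi_apply i), ?_⟩
  have h := Measure.infinitePi_map_pi
    (μ := fun _ : ℕ => (PMF.uniformOfFintype Bool).toMeasure) hf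
  simp only [hfair] at h
  exact h

/-- The coin of round `N` is fair, given the coins of the earlier rounds: it equals any prediction
`f` made from them with probability `1/2`. -/
lemma coinLaw_inter_eq {N : ℕ} {A : Set (ℕ → Bool)} (hA : DeterminedBelow N A)
    {f : (ℕ → Bool) → Bool} (hf : ∀ c c' : ℕ → Bool, (∀ r < N, c r = c' r) → f c = f c') :
    coinLaw (A ∩ {c | c N = f c}) = 2⁻¹ * coinLaw A := by
  have hE : DeterminedBelow (N + 1) {c | c N = f c} := fun c c' hc h => by
    have h1 : c N = f c := h
    change c' N = f c'
    rw [← hc N N.lt_succ_self, h1]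
    exact hf c c' fun r hr => hc r (hr.trans N.lt_succ_self)
  have hflip : ∀ c, ∀ r < N, flipCoin N c r = c r := fun c r hr => if_neg hr.ne
  -- Reversing coin `N` exchanges the events `c N = f c` and `c N ≠ f c` within `A`.
  have hpre : flipCoin N ⁻¹' (A ∩ {c | c N = f c}) = A \ {c | c N = f c} := by
    ext c
    have h1 : flipCoin N c ∈ A ↔ c ∈ A :=
      ⟨hA _ _ (hflip c), hA _ _ fun r hr => (hflip c r hr).symm⟩
    have h2 : flipCoin N c N = !c N := if_pos rfl
    have h3 : f (flipCoin N c) = f c := hf _ _ (hflip c)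
    simp only [Set.mem_preimage, Set.mem_inter_iff, Set.mem_sdiff, Set.mem_ofPred_eq, h1, h2, h3]
    cases c N <;> cases f c <;> simp
  have hmeas := ((hA.mono N.le_succ).inter hE).measurableSet
  have h1 := (measurePreserving_flipCoin N).measure_preimage hmeas.nullMeasurableSet
  rw [hpre] at h1
  have h2 := measure_inter_add_sdiff (μ := coinLaw) A hE.measurableSet
  rw [h1, ← two_mul] at h2
  rw [← h2, ← mul_assoc, ENNReal.inv_mul_cancel (by simp) (by simp), one_mul]

lemma coinLaw_past_ne_zero (past : ℕ → Bool) (r : ℕ) :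
    coinLaw {c | ∀ r' < r, c r' = past r'} ≠ 0 := by
  induction r with
  | zero => simp
  | succ r ih =>
    have hdet : DeterminedBelow r {c | ∀ r' < r, c r' = past r'} := fun c c' hc h r' hr' => by
      rw [← hc r' hr']
      exact h r' hr'
    have heq : {c : ℕ → Bool | ∀ r' < r + 1, c r' = past r'}
        = {c | ∀ r' < r, c r' = past r'} ∩ {c | c r = past r} := by
      ext c
      simp only [Set.mem_inter_iff, Set.mem_ofPred_eq, Nat.lt_succ_iff_lt_or_eq]
      constructor
      · exact fun h => ⟨fun r' hr' => h r' (Or.inl hr'), h r (Or.inr rfl)⟩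
      · rintro ⟨h1, h2⟩ r' (hr' | rfl)
        · exact h1 r' hr'
        · exact h2
    rw [heq, coinLaw_inter_eq hdet (f := fun _ => past r) fun _ _ _ => rfl]
    exact mul_ne_zero (by simp) ih

lemma tsum_two_inv_pow : ∑' j : ℕ, (2⁻¹ : ℝ≥0∞) ^ j = 2 := by
  rw [ENNReal.tsum_geometric, ENNReal.one_sub_inv_two, inv_inv]

lemma nat_le_tsum_indicator {E : ℕ → Set (ℕ → Bool)} {c : ℕ → Bool} {M : ℕ}
    (h : ∀ m < M, c ∈ E m) : (M : ℝ≥0∞) ≤ ∑' m, (E m).indicator 1 c := by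
  refine le_trans ?_ (ENNReal.sum_le_tsum (Finset.range M))
  rw [Finset.sum_congr rfl fun m hm =>
    Set.indicator_of_mem (h m (Finset.mem_range.1 hm)) (1 : (ℕ → Bool) → ℝ≥0∞)]
  simp

/-! ### The expected number of rounds -/

section Probability

variable {I : Instance n} {adv : Adversary n}

/-- When the coin of round `r` is revealed, `t + 1` non-faulty processes have signed `b` in
round `r`. -/
def Votes (I : Instance n) (adv : Adversary n) (r : ℕ) (b : Bool) : Set (ℕ → Bool) :=
  {coin | ∃ k, IsLeast {k | Revealed I (run I adv coin k) r} k ∧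
    I.t + 1 ≤ (signers ((run I adv coin k).auxSent.image AuxProof.aux) r b).card}

lemma determinedBelow_votes (ht : 3 * I.t < n) (hF : I.faulty.card ≤ I.t) {r : ℕ} (hr : 1 ≤ r)
    (b : Bool) : DeterminedBelow r (Votes I adv r b) := by
  rintro c c' hc ⟨k, hk, hv⟩
  refine ⟨k, isLeast_revealed_congr ht hF hr hc hk, ?_⟩
  rwa [← run_congr_of_isLeast ht hF hr hc hk le_rfl]

lemma determinedBelow_guaranteedAt (ht : 3 * I.t < n) (hF : I.faulty.card ≤ I.t) (s : ℕ) :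
    DeterminedBelow (s + 1) {coin | GuaranteedAt I adv coin s} := fun _ _ hc h =>
  GuaranteedAt.congr ht hF (fun r hr => hc r (Nat.lt_succ_of_le hr)) h

/-- Given any event about the coins before round `r`, decision is guaranteed at round `r` or `r + 1`
with probability at least `1/2`: the coin of round `r` is compared with the value that `t + 1`
non-faulty processes have signed, or, if there is none, with the coin of the next round. -/
lemma half_le_guaranteed (ht : 3 * I.t < n) (hF : I.faulty.card ≤ I.t)
    (hadv : ∀ᵐ coin ∂coinLaw, Admissible I adv coin) {r : ℕ} (hr : 1 ≤ r)
    {A : Set (ℕ → Bool)} (hA : DeterminedBelow r A) :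
    2⁻¹ * coinLaw A ≤
      coinLaw (A ∩ {coin | GuaranteedAt I adv coin r ∨ GuaranteedAt I adv coin (r + 1)}) := by
  classical
  set E := {coin | GuaranteedAt I adv coin r ∨ GuaranteedAt I adv coin (r + 1)}
  have hV := fun b => determinedBelow_votes (adv := adv) ht hF hr b
  set B : Set (ℕ → Bool) := {c | ∃ b, c ∈ Votes I adv r b}
  have hBdet : DeterminedBelow r B := fun c c' hc ⟨b, hb⟩ => ⟨b, hV b c c' hc hb⟩
  let f : (ℕ → Bool) → Bool := fun c => decide (c ∈ Votes I adv r true)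
  have hf : ∀ c c' : ℕ → Bool, (∀ r' < r, c r' = c' r') → f c = f c' := fun c c' hc =>
    decide_eq_decide.2 ⟨hV true c c' hc, hV true c' c fun r' hr' => (hc r' hr').symm⟩
  have h1 : 2⁻¹ * coinLaw (A ∩ B) ≤ coinLaw (A ∩ E ∩ B) := by
    rw [← coinLaw_inter_eq (hA.inter hBdet) hf]
    refine measure_mono ?_
    rintro c ⟨⟨hcA, b, hb⟩, hc⟩
    have hc : c r = f c := hc
    refine ⟨⟨hcA, Or.inl ?_⟩, b, hb⟩
    have hvote : c ∈ Votes I adv r (c r) := by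
      rw [hc]
      by_cases ht : c ∈ Votes I adv r true
      · rw [show f c = true from decide_eq_true ht]
        exact ht
      · rw [show f c = false from decide_eq_false ht]
        cases b
        · exact hb
        · exact absurd hb ht
    obtain ⟨k, hk, hv⟩ := hvote
    exact guaranteedAt_of_votes ht hF hr hk hv
  have h2 : 2⁻¹ * coinLaw (A \ B) ≤ coinLaw ((A ∩ E) \ B) := by
    change 2⁻¹ * coinLaw (A ∩ Bᶜ) ≤ _
    rw [← coinLaw_inter_eq (N := r + 1) (f := fun c => c r)
      ((hA.inter hBdet.compl).mono r.le_succ) (fun c c' hc => hc r r.lt_succ_self)]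
    refine measure_mono_ae ?_
    filter_upwards [hadv] with c hadm hc
    obtain ⟨⟨hcA, hcB⟩, hc⟩ := hc
    refine ⟨⟨hcA, Or.inr ?_⟩, hcB⟩
    obtain ⟨k, hk⟩ := hadm.exists_revealed ht hF hr
    obtain ⟨k', hk'⟩ := hadm.exists_revealed ht hF (r := r + 1) (by omega)
    obtain ⟨Y, hYF, hY, hund⟩ := exists_undecided ht hF hr hk
      fun b hb => hcB ⟨b, k, hk, hb⟩
    exact guaranteedAt_succ_of_undecided ht hF hr hk hk' hYF hY hund hc
  calc 2⁻¹ * coinLaw A = 2⁻¹ * coinLaw (A ∩ B) + 2⁻¹ * coinLaw (A \ B) := by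
        rw [← mul_add, measure_inter_add_sdiff _ hBdet.measurableSet]
    _ ≤ coinLaw (A ∩ E ∩ B) + coinLaw ((A ∩ E) \ B) := add_le_add h1 h2
    _ = coinLaw (A ∩ E) := measure_inter_add_sdiff _ hBdet.measurableSet

lemma half_le_cond_guaranteed (ht : 3 * I.t < n) (hF : I.faulty.card ≤ I.t)
    (hadv : ∀ᵐ coin ∂coinLaw, Admissible I adv coin) {r : ℕ} (hr : 1 ≤ r) (past : ℕ → Bool) :
    1 / 2 ≤ (cond coinLaw {coin | ∀ r' < r, coin r' = past r'})
      {coin | GuaranteedAt I adv coin r ∨ GuaranteedAt I adv coin (r + 1)} := by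
  have hdet : DeterminedBelow r {c | ∀ r' < r, c r' = past r'} := fun c c' hc h r' hr' => by
    rw [← hc r' hr']
    exact h r' hr'
  rw [cond_apply hdet.measurableSet]
  refine le_trans (le_of_eq ?_) (mul_le_mul_right (half_le_guaranteed ht hF hadv hr hdet) _)
  rw [mul_left_comm, ENNReal.inv_mul_cancel (coinLaw_past_ne_zero past r) (measure_ne_top _ _)]
  simp

/-- Decision is guaranteed at no round before `N`. -/
def Unguaranteed (I : Instance n) (adv : Adversary n) (N : ℕ) : Set (ℕ → Bool) :=
  {coin | ∀ s < N, ¬ GuaranteedAt I adv coin s}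

lemma determinedBelow_unguaranteed (ht : 3 * I.t < n) (hF : I.faulty.card ≤ I.t) (N : ℕ) :
    DeterminedBelow N (Unguaranteed I adv N) := fun c c' hc h s hs hg =>
  h s hs (determinedBelow_guaranteedAt ht hF s c' c
    (fun r hr => (hc r (hr.trans_le hs)).symm) hg)

lemma coinLaw_unguaranteed_le (ht : 3 * I.t < n) (hF : I.faulty.card ≤ I.t)
    (hadv : ∀ᵐ coin ∂coinLaw, Admissible I adv coin) (j : ℕ) :
    coinLaw (Unguaranteed I adv (2 * j + 1)) ≤ 2⁻¹ ^ j := by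
  induction j with
  | zero => simpa using prob_le_one
  | succ j ih =>
    have hU := determinedBelow_unguaranteed (adv := adv) ht hF (2 * j + 1)
    set U := Unguaranteed I adv (2 * j + 1)
    set E := {c | GuaranteedAt I adv c (2 * j + 1) ∨ GuaranteedAt I adv c (2 * j + 1 + 1)}
    have hEm : MeasurableSet E := (determinedBelow_guaranteedAt ht hF _).measurableSet.union
      (determinedBelow_guaranteedAt ht hF _).measurableSet
    have hsub : Unguaranteed I adv (2 * (j + 1) + 1) ⊆ U \ E := fun c hc =>
      ⟨fun s hs => hc s (by omega), fun h => h.elim (hc _ (by omega)) (hc _ (by omega))⟩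
    have h1 := half_le_guaranteed ht hF hadv (r := 2 * j + 1) (by omega) hU
    have h2 : coinLaw (U ∩ E) + coinLaw (U \ E) = coinLaw U := measure_inter_add_sdiff _ hEm
    have h3 : 2⁻¹ * coinLaw U + coinLaw (U \ E) ≤ 2⁻¹ * coinLaw U + 2⁻¹ * coinLaw U := by
      rw [← add_mul, ENNReal.inv_two_add_inv_two, one_mul]
      exact (add_le_add_left h1 _).trans h2.le
    have h4 := (ENNReal.add_le_add_iff_left
      (ENNReal.mul_ne_top (by simp) (measure_ne_top _ _))).1 h3
    calc coinLaw (Unguaranteed I adv (2 * (j + 1) + 1)) ≤ coinLaw (U \ E) := measure_mono hsub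
      _ ≤ 2⁻¹ * coinLaw U := h4
      _ ≤ 2⁻¹ * 2⁻¹ ^ j := by gcongr
      _ = 2⁻¹ ^ (j + 1) := (pow_succ' _ _).symm

lemma guaranteeRound_eq_top {coin : ℕ → Bool} (h : ¬ ∃ s, GuaranteedAt I adv coin s) :
    guaranteeRound I adv coin = ⊤ := by
  push Not at h
  simp [guaranteeRound, h]

lemma exists_first_guaranteed {coin : ℕ → Bool} (h : ∃ s, GuaranteedAt I adv coin s) :
    ∃ s, GuaranteedAt I adv coin s ∧ coin ∈ Unguaranteed I adv s ∧
      guaranteeRound I adv coin = s := by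
  classical
  refine ⟨Nat.find h, Nat.find_spec h, fun s hs => Nat.find_min h hs, le_antisymm ?_ ?_⟩
  · exact iInf₂_le _ (Nat.find_spec h)
  · exact le_iInf₂ fun s hs => by exact_mod_cast Nat.find_min' h hs

lemma guaranteeRound_le_tsum (coin : ℕ → Bool) : guaranteeRound I adv coin ≤
    ∑' j : ℕ, 2 * (Unguaranteed I adv (2 * j + 1)).indicator 1 coin := by
  rw [ENNReal.tsum_mul_left]
  by_cases h : ∃ s, GuaranteedAt I adv coin s
  · obtain ⟨s, hs, hU, heq⟩ := exists_first_guaranteed h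
    rw [heq]
    -- Decision is guaranteed at no round before `2 * j + 1` for the first `⌈s / 2⌉` numbers `j`.
    have h1 := nat_le_tsum_indicator (M := (s + 1) / 2)
      (E := fun j => Unguaranteed I adv (2 * j + 1)) (c := coin)
      fun j hj s' hs' => hU s' (by omega)
    calc (s : ℝ≥0∞) ≤ ((2 * ((s + 1) / 2) : ℕ) : ℝ≥0∞) := by
          exact_mod_cast (by omega : s ≤ 2 * ((s + 1) / 2))
      _ = 2 * (((s + 1) / 2 : ℕ) : ℝ≥0∞) := by push_cast; rfl
      _ ≤ _ := by gcongr
  · push Not at h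
    have hmem : ∀ j, coin ∈ Unguaranteed I adv (2 * j + 1) := fun j s _ => h s
    simp [hmem, Set.indicator_of_mem]

lemma lintegral_guaranteeRound_le (ht : 3 * I.t < n) (hF : I.faulty.card ≤ I.t)
    (hadv : ∀ᵐ coin ∂coinLaw, Admissible I adv coin) :
    ∫⁻ coin, guaranteeRound I adv coin ∂coinLaw ≤ 4 := by
  have hm : ∀ j, MeasurableSet (Unguaranteed I adv (2 * j + 1)) := fun j =>
    (determinedBelow_unguaranteed ht hF _).measurableSet
  calc ∫⁻ coin, guaranteeRound I adv coin ∂coinLaw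
      ≤ ∫⁻ coin, ∑' j : ℕ, 2 * (Unguaranteed I adv (2 * j + 1)).indicator 1 coin ∂coinLaw :=
        lintegral_mono guaranteeRound_le_tsum
    _ = ∑' j : ℕ, 2 * coinLaw (Unguaranteed I adv (2 * j + 1)) := by
        rw [lintegral_tsum fun j => ((measurable_one.indicator (hm j)).const_mul 2).aemeasurable]
        congr 1
        funext j
        rw [lintegral_const_mul _ (measurable_one.indicator (hm j)), lintegral_indicator_one (hm j)]
    _ ≤ ∑' j : ℕ, 2 * 2⁻¹ ^ j := by
        gcongr with j
        exact coinLaw_unguaranteed_le ht hF hadv j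
    _ = 4 := by
        rw [ENNReal.tsum_mul_left, tsum_two_inv_pow]
        norm_num

/-- Decision is guaranteed at round `s` for the first time, and none of the next `m` coins equals
the coin of round `s`. -/
def Waiting (I : Instance n) (adv : Adversary n) (s m : ℕ) : Set (ℕ → Bool) :=
  {coin | (GuaranteedAt I adv coin s ∧ coin ∈ Unguaranteed I adv s) ∧
    ∀ r, s < r → r ≤ s + m → coin r ≠ coin s}

lemma determinedBelow_waiting (ht : 3 * I.t < n) (hF : I.faulty.card ≤ I.t) (s m : ℕ) :
    DeterminedBelow (s + m + 1) (Waiting I adv s m) := fun c c' hc ⟨⟨h1, h2⟩, h3⟩ => by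
  refine ⟨⟨(determinedBelow_guaranteedAt ht hF s).mono (by omega) c c' hc h1,
    (determinedBelow_unguaranteed ht hF s).mono (by omega) c c' hc h2⟩, fun r hr hrm => ?_⟩
  rw [← hc r (by omega), ← hc s (by omega)]
  exact h3 r hr hrm

lemma coinLaw_waiting (ht : 3 * I.t < n) (hF : I.faulty.card ≤ I.t) (s m : ℕ) :
    coinLaw (Waiting I adv s m) = 2⁻¹ ^ m * coinLaw (Waiting I adv s 0) := by
  induction m with
  | zero => simp
  | succ m ih =>
    have heq : Waiting I adv s (m + 1)
        = Waiting I adv s m ∩ {c | c (s + m + 1) = !c s} := by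
      ext c
      constructor
      · intro h
        exact ⟨⟨h.1, fun r hr hrm => h.2 r hr (by omega)⟩,
          Bool.eq_not.2 (h.2 (s + m + 1) (by omega) (by omega))⟩
      · rintro ⟨h, hc⟩
        refine ⟨h.1, fun r hr hrm => ?_⟩
        rcases (show r ≤ s + m ∨ r = s + m + 1 by omega) with hr' | rfl
        · exact h.2 r hr hr'
        · exact Bool.eq_not.1 hc
    rw [heq, coinLaw_inter_eq (determinedBelow_waiting ht hF s m) (f := fun c => !c s)
      fun c c' hc => by rw [hc s (by omega)], ih, pow_succ', mul_assoc]

/-- Termination happens at the latest in the first round after the guarantee whose coin repeats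
the coin of the guarantee. -/
lemma terminationRound_le {coin : ℕ → Bool} (hadm : Admissible I adv coin) :
    terminationRound I adv coin ≤ guaranteeRound I adv coin +
      ∑' s : ℕ, ∑' m : ℕ, (Waiting I adv s m).indicator 1 coin := by
  classical
  by_cases h : ∃ s, GuaranteedAt I adv coin s
  swap
  · simp [guaranteeRound_eq_top h]
  obtain ⟨s, hs, hU, heq⟩ := exists_first_guaranteed h
  have hle : ∑' m : ℕ, (Waiting I adv s m).indicator (1 : (ℕ → Bool) → ℝ≥0∞) coin ≤
      ∑' s : ℕ, ∑' m : ℕ, (Waiting I adv s m).indicator (1 : (ℕ → Bool) → ℝ≥0∞) coin :=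
    ENNReal.le_tsum (f := fun s => ∑' m : ℕ, (Waiting I adv s m).indicator 1 coin) s
  refine le_trans ?_ (add_le_add_right hle _)
  rw [heq]
  by_cases hrep : ∃ r, s < r ∧ coin r = coin s
  · obtain ⟨⟨hsr, hr⟩, hmin⟩ := And.intro (Nat.find_spec hrep)
      fun j hj => Nat.find_min hrep (m := j) hj
    generalize Nat.find hrep = r at hsr hr hmin
    obtain ⟨-, k, -, hg⟩ := id hs
    have hdec : ∀ i ∉ I.faulty, DecidesBy I adv coin i r :=
      hg adv coin (fun _ _ => rfl) (fun _ _ => rfl) hadm r hsr hr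
    have h1 := nat_le_tsum_indicator (M := r - s) (E := fun m => Waiting I adv s m) (c := coin)
      fun m hm => ⟨⟨hs, hU⟩, fun r' hr' hrm hc => hmin r' (by omega) ⟨hr', hc⟩⟩
    calc terminationRound I adv coin ≤ (r : ℝ≥0∞) := iInf₂_le r hdec
      _ = s + ((r - s : ℕ) : ℝ≥0∞) := by
          rw [← Nat.cast_add, Nat.add_sub_cancel' hsr.le]
      _ ≤ _ := by gcongr
  · push Not at hrep
    have hmem : ∀ m, coin ∈ Waiting I adv s m := fun m => ⟨⟨hs, hU⟩, fun r hr _ => hrep r hr⟩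
    simp [hmem, Set.indicator_of_mem]

lemma lintegral_terminationRound_le (ht : 3 * I.t < n) (hF : I.faulty.card ≤ I.t)
    (hadv : ∀ᵐ coin ∂coinLaw, Admissible I adv coin) :
    ∫⁻ coin, terminationRound I adv coin ∂coinLaw ≤ 6 := by
  have hm : ∀ s m, MeasurableSet (Waiting I adv s m) := fun s m =>
    (determinedBelow_waiting ht hF s m).measurableSet
  have hmi : ∀ s m, Measurable ((Waiting I adv s m).indicator (1 : (ℕ → Bool) → ℝ≥0∞)) :=
    fun s m => measurable_one.indicator (hm s m)
  have hdisj : Pairwise (Function.onFun Disjoint fun s => Waiting I adv s 0) := by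
    intro s s' hne
    refine Set.disjoint_left.2 fun c hc hc' => ?_
    rcases hne.lt_or_gt with hlt | hlt
    · exact hc'.1.2 s hlt hc.1.1
    · exact hc.1.2 s' hlt hc'.1.1
  calc ∫⁻ coin, terminationRound I adv coin ∂coinLaw
      ≤ ∫⁻ coin, (guaranteeRound I adv coin +
          ∑' s : ℕ, ∑' m : ℕ, (Waiting I adv s m).indicator 1 coin) ∂coinLaw :=
        lintegral_mono_ae (hadv.mono fun _ => terminationRound_le)
    _ = ∫⁻ coin, guaranteeRound I adv coin ∂coinLaw +
          ∑' s : ℕ, ∑' m : ℕ, coinLaw (Waiting I adv s m) := by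
        rw [lintegral_add_right _ (Measurable.tsum fun s =>
          Measurable.tsum fun m => hmi s m)]
        congr 1
        rw [lintegral_tsum fun s => (Measurable.tsum fun m => hmi s m).aemeasurable]
        congr 1
        funext s
        rw [lintegral_tsum fun m => (hmi s m).aemeasurable]
        simp only [lintegral_indicator_one (hm _ _)]
    _ = ∫⁻ coin, guaranteeRound I adv coin ∂coinLaw +
          2 * ∑' s : ℕ, coinLaw (Waiting I adv s 0) := by
        rw [← ENNReal.tsum_mul_left]
        congr 2
        funext s
        rw [tsum_congr (coinLaw_waiting ht hF s), ENNReal.tsum_mul_right, tsum_two_inv_pow]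
    _ ≤ 4 + 2 * 1 := by
        gcongr
        · exact lintegral_guaranteeRound_le ht hF hadv
        · rw [← measure_iUnion hdisj fun s => hm s 0]
          exact prob_le_one
    _ = 6 := by norm_num

end Probability

end BBC

theorem lemma7 (n : ℕ) (I : BBC.Instance n) (ht : 3 * I.t < n) (hF : I.faulty.card ≤ I.t)
    (adv : BBC.Adversary n) (hadv : ∀ᵐ coin ∂BBC.coinLaw, BBC.Admissible I adv coin) :
    (∀ r : ℕ, 1 ≤ r → ∀ past : ℕ → Bool,
      1 / 2 ≤ (ProbabilityTheory.cond BBC.coinLaw {coin | ∀ r' < r, coin r' = past r'})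
        {coin | BBC.GuaranteedAt I adv coin r ∨ BBC.GuaranteedAt I adv coin (r + 1)}) ∧
    ∫⁻ coin, BBC.guaranteeRound I adv coin ∂BBC.coinLaw ≤ 4 ∧
    ∫⁻ coin, BBC.terminationRound I adv coin ∂BBC.coinLaw ≤ 6 :=
  ⟨fun _ hr past => BBC.half_le_cond_guaranteed ht hF hadv hr past,
    BBC.lintegral_guaranteeRound_le ht hF hadv, BBC.lintegral_terminationRound_le ht hF hadv⟩
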